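/- There exist an algorithm (a fixed program for a word RAM in which each elementary operation on a machine word costs one step) and a constant $C$ with the following property. Let $T$ be a semi-complete digraph on $n$ vertices, i.e. a digraph without loops and without multiple arcs in which any two distinct vertices are joined by at least one arc, and let $k\ge 0$ be an integer. The input consists of $n$, $k$ and the adjacency matrix of $T$, and the machine words have $w$ bits for some $w\ge C(k+\lfloor\log_2 \max(n,1)\rfloor+1)$. Then, in at most $C\cdot 2^{Ck}\cdot n^2$ steps (that is, in time $O(2^{O(k)}|V(T)|^2)$; at most $C\cdot 2^{Ck}$ steps if $n=0$), the algorithm either outputs an ordering of $V(T)$ of width at most $k$, or correctly concludes that $\mathbf{ctw}(T)>k$. Here the width of an ordering $\pi$ of $V(T)$ is $\max_{0\le\alpha\le n}|E(\pi[\alpha],V(T)\setminus\pi[\alpha])|$, where $\pi[\alpha]$ is the set of the first $\alpha$ vertices of $\pi$ and $E(X,Y)$ is the set of arcs with tail in $X$ and head in $Y$; the cutwidth $\mathbf{ctw}(T)$ is the minimum width over all orderings of $V(T)$. -/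

import Mathlib

/-! Semi-complete digraphs, orderings and cutwidth. -/

namespace Digraph

/-- A digraph is semi-complete if it has no loops and any two distinct vertices are joined by at
least one arc. (Multiple arcs cannot occur, since adjacency is a relation.) -/
def IsSemicomplete {V : Type*} (G : Digraph V) : Prop :=
  (∀ v, ¬ G.Adj v v) ∧ ∀ v w, v ≠ w → G.Adj v w ∨ G.Adj w v

/-- The set `E(X, Y)` of arcs with tail in `X` and head in `Y`. -/
def arcsBetween {V : Type*} (G : Digraph V) (X Y : Set V) : Set (V × V) :=
  {e | G.Adj e.1 e.2 ∧ e.1 ∈ X ∧ e.2 ∈ Y}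

/-- The first `a` vertices of the ordering `π`; here `π i` is the vertex at position `i`
(counted from `0`). -/
def orderingPrefix {V : Type*} {n : ℕ} (π : Fin n ≃ V) (a : ℕ) : Set V :=
  {v | (π.symm v : ℕ) < a}

/-- The width of an ordering: the maximum over `0 ≤ a ≤ n` of the number of arcs from the first
`a` vertices to the remaining ones. -/
noncomputable def orderingWidth {V : Type*} {n : ℕ} (G : Digraph V) (π : Fin n ≃ V) : ℕ :=
  (Finset.range (n + 1)).sup fun a =>
    (G.arcsBetween (orderingPrefix π a) (orderingPrefix π a)ᶜ).ncard

/-- The cutwidth of a finite digraph: the minimum width over all orderings of its vertices. -/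
noncomputable def cutwidth {V : Type*} [Finite V] (G : Digraph V) : ℕ :=
  sInf {m | ∃ (n : ℕ) (π : Fin n ≃ V), G.orderingWidth π = m}

end Digraph

/-! A unit-cost word RAM with structured control flow. -/

namespace WordRAM

/-- A machine state: the contents of the registers and of the random access memory. A program
mentions only finitely many registers, by fixed names; memory cells are addressed by computed
values. -/
structure State where
  reg : ℕ → ℕ
  mem : ℕ → ℕ

/-- Expressions. `load e` is the content of the memory cell whose address is the value of `e`. -/
inductive Expr where
  | const (c : ℕ)
  | reg (x : ℕ)
  | load (e : Expr)
  | add (a b : Expr)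
  | sub (a b : Expr)
  | mul (a b : Expr)
  | div (a b : Expr)

/-- The value of an expression. Subtraction is truncated at `0`; division is rounded down, and
division by `0` gives `0`. -/
def Expr.eval (s : State) : Expr → ℕ
  | .const c => c
  | .reg x => s.reg x
  | .load e => s.mem (e.eval s)
  | .add a b => a.eval s + b.eval s
  | .sub a b => a.eval s - b.eval s
  | .mul a b => a.eval s * b.eval s
  | .div a b => a.eval s / b.eval s

/-- The number of elementary operations in an expression: every constant, register access, memory
access and arithmetic operation costs one step. -/
def Expr.cost : Expr → ℕ
  | .const _ => 1
  | .reg _ => 1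
  | .load e => e.cost + 1
  | .add a b => a.cost + b.cost + 1
  | .sub a b => a.cost + b.cost + 1
  | .mul a b => a.cost + b.cost + 1
  | .div a b => a.cost + b.cost + 1

/-- All values (addresses included) that arise when the expression is evaluated fit into a machine
word of `w` bits. -/
def Expr.Fits (w : ℕ) (s : State) : Expr → Prop
  | .const c => c < 2 ^ w
  | .reg x => s.reg x < 2 ^ w
  | .load e => e.Fits w s ∧ s.mem (e.eval s) < 2 ^ w
  | .add a b => a.Fits w s ∧ b.Fits w s ∧ a.eval s + b.eval s < 2 ^ w
  | .sub a b => a.Fits w s ∧ b.Fits w s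
  | .mul a b => a.Fits w s ∧ b.Fits w s ∧ a.eval s * b.eval s < 2 ^ w
  | .div a b => a.Fits w s ∧ b.Fits w s

/-- Programs. `assign x e` writes the value of `e` to register `x`; `store a e` writes the value of
`e` to the memory cell with address the value of `a`; `ite e p q` runs `p` if the value of `e` is
nonzero and `q` otherwise; `loop e p` repeats `p` as long as the value of `e` is nonzero. -/
inductive Program where
  | skip
  | assign (x : ℕ) (e : Expr)
  | store (a e : Expr)
  | seq (p q : Program)
  | ite (e : Expr) (p q : Program)
  | loop (e : Expr) (p : Program)

/-- `Runs w p s t s'`: on a machine with words of `w` bits, program `p` started in state `s` halts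
after exactly `t` steps in state `s'`. A program gets stuck, and so has no run, as soon as a
value does not fit into a word. -/
inductive Runs (w : ℕ) : Program → State → ℕ → State → Prop where
  | skip (s : State) : Runs w .skip s 1 s
  | assign (s : State) (x : ℕ) (e : Expr) (he : e.Fits w s) :
      Runs w (.assign x e) s (e.cost + 1) ⟨Function.update s.reg x (e.eval s), s.mem⟩
  | store (s : State) (a e : Expr) (ha : a.Fits w s) (he : e.Fits w s) :
      Runs w (.store a e) s (a.cost + e.cost + 1)
        ⟨s.reg, Function.update s.mem (a.eval s) (e.eval s)⟩
  | seq {p q : Program} {s s' s'' : State} {t t' : ℕ}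
      (hp : Runs w p s t s') (hq : Runs w q s' t' s'') : Runs w (.seq p q) s (t + t') s''
  | iteTrue {e : Expr} {p q : Program} {s s' : State} {t : ℕ} (he : e.Fits w s)
      (h : e.eval s ≠ 0) (hp : Runs w p s t s') : Runs w (.ite e p q) s (e.cost + 1 + t) s'
  | iteFalse {e : Expr} {p q : Program} {s s' : State} {t : ℕ} (he : e.Fits w s)
      (h : e.eval s = 0) (hq : Runs w q s t s') : Runs w (.ite e p q) s (e.cost + 1 + t) s'
  | loopDone {e : Expr} {p : Program} {s : State} (he : e.Fits w s)
      (h : e.eval s = 0) : Runs w (.loop e p) s (e.cost + 1) s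
  | loopStep {e : Expr} {p : Program} {s s' s'' : State} {t t' : ℕ} (he : e.Fits w s)
      (h : e.eval s ≠ 0) (hp : Runs w p s t s') (hl : Runs w (.loop e p) s' t' s'') :
      Runs w (.loop e p) s (e.cost + 1 + t + t') s''

/-- The machine is deterministic: running time and final state are determined by program and
initial state. -/
theorem Runs.deterministic {w : ℕ} {p : Program} {s s₁ s₂ : State} {t₁ t₂ : ℕ}
    (h₁ : Runs w p s t₁ s₁) (h₂ : Runs w p s t₂ s₂) : t₁ = t₂ ∧ s₁ = s₂ := by
  induction h₁ generalizing t₂ s₂ with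
  | skip => cases h₂; exact ⟨rfl, rfl⟩
  | assign => cases h₂; exact ⟨rfl, rfl⟩
  | store => cases h₂; exact ⟨rfl, rfl⟩
  | seq _ _ ihp ihq =>
    cases h₂ with
    | seq a b =>
      obtain ⟨rfl, rfl⟩ := ihp a
      obtain ⟨rfl, rfl⟩ := ihq b
      exact ⟨rfl, rfl⟩
  | iteTrue _ h _ ih =>
    cases h₂ with
    | iteTrue _ _ a => obtain ⟨rfl, rfl⟩ := ih a; exact ⟨rfl, rfl⟩
    | iteFalse _ h' _ => exact absurd h' h
  | iteFalse _ h _ ih =>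
    cases h₂ with
    | iteTrue _ h' _ => exact absurd h h'
    | iteFalse _ _ a => obtain ⟨rfl, rfl⟩ := ih a; exact ⟨rfl, rfl⟩
  | loopDone _ h =>
    cases h₂ with
    | loopDone => exact ⟨rfl, rfl⟩
    | loopStep _ h' _ _ => exact absurd h h'
  | loopStep _ h _ _ ihp ihl =>
    cases h₂ with
    | loopDone _ h' => exact absurd h' h
    | loopStep _ _ a b =>
      obtain ⟨rfl, rfl⟩ := ihp a
      obtain ⟨rfl, rfl⟩ := ihl b
      exact ⟨rfl, rfl⟩

open Classical in
/-- The initial state for the input `(T, k)`: register `0` holds the number `n` of vertices,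
register `1` holds `k`, and the memory cells `0, …, n² - 1` hold the adjacency matrix of `T` row by
row (cell `i * n + j` holds `1` if `(i, j)` is an arc and `0` otherwise). Everything else is `0`. -/
noncomputable def inputState {n : ℕ} (T : Digraph (Fin n)) (k : ℕ) : State where
  reg := fun x => if x = 0 then n else if x = 1 then k else 0
  mem := fun a => if ∃ i j : Fin n, a = (i : ℕ) * n + (j : ℕ) ∧ T.Adj i j then 1 else 0

end WordRAM

/-! ### Reasoning about running programs -/

namespace WordRAM

/-! Fix an ordering of width at most `k`. At most `k` arcs lead from `v` to later vertices, as they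
cross the cut just after `v`; and since `T` is semi-complete, all but at most `k` of the vertices
before `v` are out-neighbours of `v`. Hence the out-degree of `v` differs from its position by at
most `k` (`outdeg_le`, `le_outdeg`), and its rank in the order by out-degree differs from its
position by at most `2k` (`rank_le`, `le_rank`).

Name the vertices by their ranks. The first `a` vertices of the ordering then include every number
below `a - 2k` and none from `a + 2k` on, so a window of `4k` bits determines this set, and there
are only `16^k` candidates per level `a`. A dynamic program over pairs of a level and a mask decides
whether a chain of sets with cut at most `k`, each obtained from the previous one by adding a
vertex, leads from the empty set to the full one (`Reach`). A good ordering gives such a chain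
(`Reach.of_width_le`). Conversely, every chain gives an ordering of width at most `k`
(`exists_ordering_of_edges`), independently of the degrees.

Adding `v` to a set changes its cut by the arcs from `v` to the outside minus the arcs from the set
to `v` (`cut_insert`), which are counted in `O(n)` steps. There are `n * 16^k` entries to fill, with
`4k + 1` candidates for the last vertex each, so the time is `2^(O(k)) n^2`. One entry encodes both
the cut and the last vertex, so it serves the updates as well as the reconstruction of the ordering.

The machine side is a small program logic: `Within` asserts termination within a time budget
together with a postcondition, `Within.forLoop_frame` is the loop rule, and `Fit` collects the
bounds that keep all values within a word. -/

instance : Add Expr := ⟨Expr.add⟩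
instance : Sub Expr := ⟨Expr.sub⟩
instance : Mul Expr := ⟨Expr.mul⟩
instance : Div Expr := ⟨Expr.div⟩
instance (c : ℕ) : OfNat Expr c := ⟨Expr.const c⟩

/-- The program `p` is followed by the program `q`. -/
infixr:60 " ;; " => Program.seq

/-- The value of an expression is assigned to a register. -/
infix:61 " ::= " => Program.assign

namespace Expr

variable (s : State) (a b : Expr) (c w : ℕ)

@[simp] theorem eval_reg : (reg c).eval s = s.reg c := rfl
@[simp] theorem eval_load : (load a).eval s = s.mem (a.eval s) := rfl
@[simp] theorem eval_ofNat : (ofNat(c) : Expr).eval s = c := rfl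
@[simp] theorem eval_hAdd : (a + b).eval s = a.eval s + b.eval s := rfl
@[simp] theorem eval_hSub : (a - b).eval s = a.eval s - b.eval s := rfl
@[simp] theorem eval_hMul : (a * b).eval s = a.eval s * b.eval s := rfl
@[simp] theorem eval_hDiv : (a / b).eval s = a.eval s / b.eval s := rfl

@[simp] theorem cost_reg : (reg c).cost = 1 := rfl
@[simp] theorem cost_load : (load a).cost = a.cost + 1 := rfl
@[simp] theorem cost_ofNat : (ofNat(c) : Expr).cost = 1 := rfl
@[simp] theorem cost_hAdd : (a + b).cost = a.cost + b.cost + 1 := rfl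
@[simp] theorem cost_hSub : (a - b).cost = a.cost + b.cost + 1 := rfl
@[simp] theorem cost_hMul : (a * b).cost = a.cost + b.cost + 1 := rfl
@[simp] theorem cost_hDiv : (a / b).cost = a.cost + b.cost + 1 := rfl

@[simp] theorem fits_reg : (reg c).Fits w s ↔ s.reg c < 2 ^ w := Iff.rfl
@[simp] theorem fits_load : (load a).Fits w s ↔ a.Fits w s ∧ s.mem (a.eval s) < 2 ^ w := Iff.rfl
@[simp] theorem fits_ofNat : (ofNat(c) : Expr).Fits w s ↔ c < 2 ^ w := Iff.rfl
@[simp] theorem fits_hAdd :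
    (a + b).Fits w s ↔ a.Fits w s ∧ b.Fits w s ∧ a.eval s + b.eval s < 2 ^ w := Iff.rfl
@[simp] theorem fits_hSub : (a - b).Fits w s ↔ a.Fits w s ∧ b.Fits w s := Iff.rfl
@[simp] theorem fits_hMul :
    (a * b).Fits w s ↔ a.Fits w s ∧ b.Fits w s ∧ a.eval s * b.eval s < 2 ^ w := Iff.rfl
@[simp] theorem fits_hDiv : (a / b).Fits w s ↔ a.Fits w s ∧ b.Fits w s := Iff.rfl

end Expr

namespace State

/-- The state after register `x` has been overwritten with `v`. -/
def setReg (s : State) (x v : ℕ) : State := ⟨Function.update s.reg x v, s.mem⟩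

/-- The state after memory cell `a` has been overwritten with `v`. -/
def setMem (s : State) (a v : ℕ) : State := ⟨s.reg, Function.update s.mem a v⟩

variable (s : State) (x y v a b : ℕ)

@[simp] theorem reg_setReg : (s.setReg x v).reg y = if y = x then v else s.reg y := by
  simp [setReg, Function.update_apply]
@[simp] theorem mem_setReg : (s.setReg x v).mem = s.mem := rfl
@[simp] theorem reg_setMem : (s.setMem a v).reg = s.reg := rfl
@[simp] theorem mem_setMem : (s.setMem a v).mem b = if b = a then v else s.mem b := by
  simp [setMem, Function.update_apply]

end State

/-- Started in `s`, the program `p` halts after at most `T` steps in a state that satisfies `Q`. -/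
def Within (w : ℕ) (p : Program) (s : State) (T : ℕ) (Q : State → Prop) : Prop :=
  ∃ t s', Runs w p s t s' ∧ t ≤ T ∧ Q s'

namespace Within

variable {w T T' : ℕ} {p q : Program} {s : State} {Q R : State → Prop} {e : Expr}

theorem mono (h : Within w p s T Q) (hT : T ≤ T') (hQ : ∀ s', Q s' → R s') :
    Within w p s T' R := by
  obtain ⟨t, s', h1, h2, h3⟩ := h
  exact ⟨t, s', h1, h2.trans hT, hQ _ h3⟩

theorem of_le (h : Within w p s T Q) (hT : T ≤ T') : Within w p s T' Q :=
  h.mono hT fun _ => id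

theorem skip (h : Q s) (hT : 1 ≤ T) : Within w .skip s T Q := ⟨1, s, .skip s, hT, h⟩

theorem assign {x : ℕ} (he : e.Fits w s) (h : Q (s.setReg x (e.eval s)))
    (hT : e.cost + 1 ≤ T) : Within w (x ::= e) s T Q :=
  ⟨_, _, .assign s x e he, hT, h⟩

theorem store {a : Expr} (ha : a.Fits w s) (he : e.Fits w s)
    (h : Q (s.setMem (a.eval s) (e.eval s))) (hT : a.cost + e.cost + 1 ≤ T) :
    Within w (.store a e) s T Q :=
  ⟨_, _, .store s a e ha he, hT, h⟩

/-- The rest of the program gets the budget that remains, so time is accounted for by subtraction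
while a program is followed from its front. -/
theorem seq (h : Within w p s T' fun s' => Within w q s' (T - T') Q) (hT : T' ≤ T) :
    Within w (p ;; q) s T Q := by
  obtain ⟨t, s', h1, h2, t', s'', h3, h4, h5⟩ := h
  exact ⟨_, _, .seq h1 h3, by omega, h5⟩

theorem assign_seq {x : ℕ} (he : e.Fits w s) (hT : e.cost + 1 ≤ T)
    (h : Within w q (s.setReg x (e.eval s)) (T - (e.cost + 1)) Q) :
    Within w (x ::= e ;; q) s T Q :=
  seq (assign he h le_rfl) hT

theorem store_seq {a : Expr} (ha : a.Fits w s) (he : e.Fits w s)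
    (hT : a.cost + e.cost + 1 ≤ T)
    (h : Within w q (s.setMem (a.eval s) (e.eval s)) (T - (a.cost + e.cost + 1)) Q) :
    Within w (.store a e ;; q) s T Q :=
  seq (store ha he h le_rfl) hT

theorem ite (he : e.Fits w s) (hT : e.cost + 1 ≤ T)
    (hp : e.eval s ≠ 0 → Within w p s (T - (e.cost + 1)) Q)
    (hq : e.eval s = 0 → Within w q s (T - (e.cost + 1)) Q) :
    Within w (.ite e p q) s T Q := by
  by_cases h : e.eval s = 0
  · obtain ⟨t, s', h1, h2, h3⟩ := hq h
    exact ⟨_, _, .iteFalse he h h1, by omega, h3⟩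
  · obtain ⟨t, s', h1, h2, h3⟩ := hp h
    exact ⟨_, _, .iteTrue he h h1, by omega, h3⟩

end Within

/-- The registers that a program writes. -/
def Program.writes : Program → List ℕ
  | .skip => []
  | .assign x _ => [x]
  | .store _ _ => []
  | .seq p q => p.writes ++ q.writes
  | .ite _ p q => p.writes ++ q.writes
  | .loop _ p => p.writes

/-- The program does not write to the memory. -/
def Program.Storeless : Program → Prop
  | .skip => True
  | .assign _ _ => True
  | .store _ _ => False
  | .seq p q => p.Storeless ∧ q.Storeless
  | .ite _ p q => p.Storeless ∧ q.Storeless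
  | .loop _ p => p.Storeless

/-- `Program.writes` is syntactic, so for a concrete program and register the side condition is
settled by `decide`. -/
theorem Runs.reg_eq {w : ℕ} {p : Program} {s s' : State} {t : ℕ} (h : Runs w p s t s') :
    ∀ x ∉ p.writes, s'.reg x = s.reg x := by
  induction h with
  | skip => intros; rfl
  | assign s x e _ =>
    intro y hy
    have : y ≠ x := by simpa [Program.writes] using hy
    simp [this]
  | store => intros; rfl
  | seq _ _ ihp ihq =>
    intro x hx
    simp only [Program.writes, List.mem_append, not_or] at hx
    rw [ihq x hx.2, ihp x hx.1]
  | iteTrue _ _ _ ih =>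
    intro x hx
    simp only [Program.writes, List.mem_append, not_or] at hx
    exact ih x hx.1
  | iteFalse _ _ _ ih =>
    intro x hx
    simp only [Program.writes, List.mem_append, not_or] at hx
    exact ih x hx.2
  | loopDone => intros; rfl
  | loopStep _ _ _ _ ihp ihl =>
    intro x hx
    rw [ihl x hx, ihp x hx]

theorem Runs.mem_eq {w : ℕ} {p : Program} {s s' : State} {t : ℕ} (h : Runs w p s t s')
    (hp : p.Storeless) : s'.mem = s.mem := by
  induction h with
  | skip => rfl
  | assign => rfl
  | store => exact hp.elim
  | seq _ _ ihp ihq => rw [ihq hp.2, ihp hp.1]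
  | iteTrue _ _ _ ih => exact ih hp.1
  | iteFalse _ _ _ ih => exact ih hp.2
  | loopDone => rfl
  | loopStep _ _ _ _ ihp ihl => rw [ihl hp, ihp hp]

theorem Within.frame {w T : ℕ} {p : Program} {s : State} {Q : State → Prop}
    (h : Within w p s T Q) :
    Within w p s T fun s' => Q s' ∧ ∀ x ∉ p.writes, s'.reg x = s.reg x := by
  obtain ⟨t, s', h1, h2, h3⟩ := h
  exact ⟨t, s', h1, h2, h3, h1.reg_eq⟩

theorem Within.frame_mem {w T : ℕ} {p : Program} {s : State} {Q : State → Prop}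
    (h : Within w p s T Q) (hp : p.Storeless) :
    Within w p s T fun s' => Q s' ∧ (∀ x ∉ p.writes, s'.reg x = s.reg x) ∧ s'.mem = s.mem := by
  obtain ⟨t, s', h1, h2, h3⟩ := h
  exact ⟨t, s', h1, h2, h3, h1.reg_eq, h1.mem_eq hp⟩

/-- Run `p` with register `x` equal to `0, 1, …`, as long as it is smaller than register `b`. -/
def Program.forLoop (x b : ℕ) (p : Program) : Program :=
  x ::= 0 ;; .loop (.reg b - .reg x) (p ;; x ::= .reg x + 1)

/-- The invariant is demanded after the counter has been advanced, so it may mention the counter.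
Each round pays 8 steps for the test and the increment; the final 6 pay for the initialization and
the failing test. -/
theorem Within.forLoop {w x b N T : ℕ} {p : Program} {s : State} (I : ℕ → State → Prop)
    (hw : N + 1 < 2 ^ w) (hxb : x ≠ b) (hx : x ∉ p.writes) (hb : b ∉ p.writes)
    (hs : s.reg b = N) (h0 : I 0 (s.setReg x 0))
    (step : ∀ i < N, ∀ s, I i s → s.reg x = i → s.reg b = N →
      Within w p s T fun s' => I (i + 1) (s'.setReg x (i + 1))) :
    Within w (.forLoop x b p) s (N * (T + 8) + 6) (I N) := by
  -- Induction on the number `d` of remaining rounds, because `Runs` unfolds a loop from its front.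
  have key : ∀ d i s, i + d = N → I i s → s.reg x = i → s.reg b = N →
      Within w (.loop (.reg b - .reg x) (p ;; x ::= .reg x + 1)) s (d * (T + 8) + 4) (I N) := by
    intro d
    induction d with
    | zero =>
      intro i s hd hI hx hb
      obtain rfl : i = N := by omega
      refine ⟨_, s, .loopDone ?_ ?_, ?_, hI⟩
      · simp only [Expr.fits_hSub, Expr.fits_reg]; omega
      · simp [hx, hb]
      · simp
    | succ d ih =>
      intro i s hd hI hsx hsb
      obtain ⟨t, s', h1, h2, h3⟩ := (step i (by omega) s hI hsx hsb).frame
      have hx' : s'.reg x = i := by rw [h3.2 x hx, hsx]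
      have hb' : s'.reg b = N := by rw [h3.2 b hb, hsb]
      obtain ⟨t', s'', h4, h5, h6⟩ := ih (i + 1) (s'.setReg x (i + 1)) (by omega) h3.1
        (by simp) (by simp [hxb.symm, hb'])
      have hfits : (Expr.reg x + 1).Fits w s' := by
        simp only [Expr.fits_hAdd, Expr.fits_reg, Expr.fits_ofNat, Expr.eval_reg,
          Expr.eval_ofNat]
        omega
      have h7 := Runs.assign (w := w) s' x (Expr.reg x + 1) hfits
      have h8 : Runs w (.loop (.reg b - .reg x) (p ;; x ::= .reg x + 1)) s _ s'' :=
        .loopStep (by simp only [Expr.fits_hSub, Expr.fits_reg]; omega)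
          (by simp only [Expr.eval_hSub, Expr.eval_reg]; omega) (.seq h1 h7) (by
            have : (Expr.reg x + 1).eval s' = i + 1 := by simp [hx']
            rw [this]; exact h4)
      refine ⟨_, s'', h8, ?_, h6⟩
      simp only [Expr.cost_hSub, Expr.cost_hAdd, Expr.cost_reg, Expr.cost_ofNat]
      have : (d + 1) * (T + 8) = d * (T + 8) + T + 8 := by ring
      omega
  refine Within.assign_seq (by simp) (by simp)
    ((key N 0 (s.setReg x 0) (by omega) h0 (by simp) (by simp [hxb.symm, hs])).of_le ?_)
  simp

/-- The frame facts relative to the state before the loop are carried along in the invariant, so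
that an application needs to mention only what changes. -/
theorem Within.forLoop_frame {w x b N T : ℕ} {p : Program} {s₀ : State}
    (I : ℕ → State → Prop)
    (hw : N + 1 < 2 ^ w) (hxb : x ≠ b) (hx : x ∉ p.writes) (hb : b ∉ p.writes)
    (hs : s₀.reg b = N) (h0 : I 0 (s₀.setReg x 0))
    (step : ∀ i < N, ∀ s, I i s → s.reg x = i → (∀ y ∉ x :: p.writes, s.reg y = s₀.reg y) →
      (p.Storeless → s.mem = s₀.mem) →
      Within w p s T fun s' => I (i + 1) (s'.setReg x (i + 1))) :
    Within w (.forLoop x b p) s₀ (N * (T + 8) + 6) (I N) := by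
  refine (Within.forLoop (N := N) (T := T) (fun i s => I i s ∧
      (∀ y ∉ x :: p.writes, s.reg y = s₀.reg y) ∧ (p.Storeless → s.mem = s₀.mem))
      hw hxb hx hb hs ⟨h0, ?_, fun _ => rfl⟩ ?_).mono le_rfl fun _ h => h.1
  · intro y hy
    simp only [List.mem_cons, not_or] at hy
    simp [hy.1]
  · rintro i hi s ⟨h1, h2, h3⟩ hsx -
    obtain ⟨t, s', h4, h5, h6⟩ := step i hi s h1 hsx h2 h3
    refine ⟨t, s', h4, h5, h6, fun y hy => ?_, fun hp => ?_⟩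
    · rw [← h2 y hy]
      simp only [List.mem_cons, not_or] at hy
      simp [hy.1, h4.reg_eq y hy.2]
    · rw [State.mem_setReg, h4.mem_eq hp, h3 hp]

end WordRAM

/-! ### Cuts, masks and degrees -/

namespace CutDP

open Finset

/-- No carry occurs because bit `j` is clear; thus the machine can set a bit by plain addition. -/
theorem testBit_add_two_pow {m j : ℕ} (h : m.testBit j = false) (i : ℕ) :
    (m + 2 ^ j).testBit i = (m.testBit i || decide (i = j)) := by
  induction j generalizing m i with
  | zero =>
    have h0 : m % 2 = 0 := by simpa using h
    cases i with
    | zero => simp; omega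
    | succ i =>
      have : (m + 1) / 2 = m / 2 := by omega
      simp [Nat.testBit_succ, this]
  | succ j ih =>
    have h1 : (m + 2 ^ (j + 1)) / 2 = m / 2 + 2 ^ j := by rw [pow_succ]; omega
    cases i with
    | zero => simp [pow_succ]
    | succ i =>
      rw [Nat.testBit_succ, h1, ih (by rwa [Nat.testBit_succ] at h), Nat.testBit_succ]
      simp

/-- `pos` numbers the numbers below `n`, and `c` is its inverse. -/
structure IsNumbering (n : ℕ) (pos c : ℕ → ℕ) : Prop where
  pos_lt : ∀ v < n, pos v < n
  lt : ∀ i < n, c i < n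
  left_inv : ∀ v < n, c (pos v) = v
  right_inv : ∀ i < n, pos (c i) = i

/-- The total weight of the arcs that leave the set `X` of numbers below `n`. -/
def cut (n : ℕ) (b : ℕ → ℕ → ℕ) (X : Finset ℕ) : ℕ :=
  ∑ p ∈ X, ∑ q ∈ range n \ X, b p q

/-- Arcs from `v` to the outside are gained and arcs from `X` to `v` are lost. As there is no loop
at `v`, it does not matter that the last sum still counts `v` as outside. -/
theorem cut_insert {n : ℕ} {b : ℕ → ℕ → ℕ} {X : Finset ℕ} {v : ℕ} (hv : v ∉ X) (hn : v < n)
    (hb : b v v = 0) :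
    cut n b (insert v X) + ∑ q ∈ X, b q v = cut n b X + ∑ q ∈ range n \ X, b v q := by
  have h1 : range n \ insert v X = (range n \ X).erase v := by
    ext q; simp only [mem_sdiff, mem_insert, mem_erase]; tauto
  have h2 : v ∈ range n \ X := by simp [hv, hn]
  have h3 : ∀ p, ∑ q ∈ (range n \ X).erase v, b p q + b p v = ∑ q ∈ range n \ X, b p q :=
    fun p => sum_erase_add _ _ h2
  unfold cut
  rw [sum_insert hv, h1, ← h3 v, hb, ← sum_congr rfl fun p _ => h3 p, sum_add_distrib]
  ring

/-- Invariance under relabelling: the dynamic program works with ranks, whereas the width refers to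
the original names. -/
theorem cut_filter_comp {n : ℕ} {A : ℕ → ℕ → ℕ} {r σ : ℕ → ℕ} (hσ : IsNumbering n r σ)
    (P : ℕ → Prop) [DecidablePred P] :
    cut n (fun p q => A (σ p) (σ q)) ((range n).filter fun p => P (σ p)) =
      cut n A ((range n).filter P) := by
  have key : ∀ (Q : ℕ → Prop) [DecidablePred Q] (f : ℕ → ℕ),
      ∑ p ∈ (range n).filter (fun p => Q (σ p)), f (σ p) = ∑ v ∈ (range n).filter Q, f v := by
    intro Q _ f
    refine sum_nbij' σ r ?_ ?_ ?_ ?_ ?_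
    · intro p hp
      simp only [mem_filter, mem_range] at hp ⊢
      exact ⟨hσ.lt _ hp.1, hp.2⟩
    · intro v hv
      simp only [mem_filter, mem_range] at hv ⊢
      exact ⟨hσ.pos_lt _ hv.1, by rw [hσ.left_inv _ hv.1]; exact hv.2⟩
    · intro p hp
      simp only [mem_filter, mem_range] at hp
      exact hσ.right_inv _ hp.1
    · intro v hv
      simp only [mem_filter, mem_range] at hv
      exact hσ.left_inv _ hv.1
    · intros; rfl
  have h1 : ∀ (Q : ℕ → Prop) [DecidablePred Q],
      range n \ (range n).filter Q = (range n).filter fun x => ¬ Q x := fun Q _ => by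
    rw [filter_not]
  unfold cut
  rw [h1, h1, ← key P fun v => ∑ q ∈ (range n).filter (fun x => ¬ P x), A v q]
  exact sum_congr rfl fun p _ => key (fun x => ¬ P x) fun v => A (σ p) v

/-! #### Masks -/

/-- The set of the first `a` vertices that is encoded by the mask `m`: bit `i` of `m` tells whether
`a + i - 2 * k` belongs to it, and it contains every number below `a - 2 * k`. -/
def prefixSet (n k a m : ℕ) : Finset ℕ :=
  (range n).filter fun p => p + 2 * k < a ∨ m.testBit (p + 2 * k - a) = true

theorem mem_prefixSet {n k a m p : ℕ} : p ∈ prefixSet n k a m ↔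
    p < n ∧ (p + 2 * k < a ∨ m.testBit (p + 2 * k - a) = true) := by
  simp [prefixSet]

/-- Adding the vertex `a + j - 2 * k` to the prefix encoded by `m` yields the prefix encoded by
`m'`, whose cut is small. -/
structure Edge (n k : ℕ) (b : ℕ → ℕ → ℕ) (a m j m' : ℕ) : Prop where
  bit : m.testBit j = false
  -- From level `a` to `a + 1` the window moves by one. The bit shifted out must be set, since
  -- everything below `a + 1 - 2 * k` has to be present; this is the `1` on the left. The value `j =
  -- 4 * k` is just outside the old window but inside the new one, and `lo` and `hi` say that the
  -- added number is a genuine vertex.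
  eq : 2 * m' + 1 = m + 2 ^ j
  le : j ≤ 4 * k
  lo : 2 * k ≤ a + j
  hi : a + j < n + 2 * k
  cut_le : cut n b (prefixSet n k (a + 1) m') ≤ k

theorem notMem_prefixSet {n k a m j : ℕ} (bit : m.testBit j = false) (lo : 2 * k ≤ a + j) :
    a + j - 2 * k ∉ prefixSet n k a m := by
  rw [mem_prefixSet]
  have : a + j - 2 * k + 2 * k - a = j := by omega
  rw [this, bit]
  simp; omega

/-- A number is below both windows, or is the one whose bit is shifted out, or is read from both
masks at bit indices that differ by one. -/
theorem prefixSet_succ {n k a m j m' : ℕ} (bit : m.testBit j = false)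
    (eq : 2 * m' + 1 = m + 2 ^ j) (lo : 2 * k ≤ a + j) (hi : a + j < n + 2 * k) :
    prefixSet n k (a + 1) m' = insert (a + j - 2 * k) (prefixSet n k a m) := by
  have hb := testBit_add_two_pow bit
  rw [← eq] at hb
  ext p
  rw [mem_insert, mem_prefixSet, mem_prefixSet]
  rcases lt_trichotomy (p + 2 * k) a with h | h | h
  · constructor
    · rintro ⟨h1, -⟩; exact .inr ⟨h1, .inl h⟩
    · rintro (h1 | ⟨h1, -⟩) <;> exact ⟨by omega, .inl (by omega)⟩
  · have h0 := hb 0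
    simp only [Nat.testBit_zero] at h0
    have e : p + 2 * k - a = 0 := by omega
    rw [e, Nat.testBit_zero]
    have h2 : decide ((2 * m' + 1) % 2 = 1) = true := by simp
    rw [h2] at h0
    simp only [Bool.true_eq, Bool.or_eq_true] at h0
    constructor
    · rintro ⟨h1, -⟩
      rcases h0 with h0 | h0
      · exact .inr ⟨h1, .inr h0⟩
      · have := of_decide_eq_true h0
        left; omega
    · rintro (h1 | ⟨h1, -⟩) <;> exact ⟨by omega, .inl (by omega)⟩
  · have h0 := hb (p + 2 * k - (a + 1) + 1)
    have e : p + 2 * k - (a + 1) + 1 = p + 2 * k - a := by omega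
    have e2 : (2 * m' + 1) / 2 = m' := by omega
    rw [Nat.testBit_succ, e2, e] at h0
    rw [h0, Bool.or_eq_true, decide_eq_true_eq]
    constructor
    · rintro ⟨h1, h2 | h2 | h2⟩
      · omega
      · exact .inr ⟨h1, .inr h2⟩
      · left; omega
    · rintro (h1 | ⟨h1, h2 | h2⟩)
      · exact ⟨by omega, .inr (.inr (by omega))⟩
      · omega
      · exact ⟨h1, .inr (.inl h2)⟩

/-- The mask `m` encodes the set of the first `a` vertices of some ordering of small width. -/
def Reach (n k : ℕ) (b : ℕ → ℕ → ℕ) : ℕ → ℕ → Prop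
  -- At level `0` the lower `2k` bits of the window stand for negative numbers, which count as
  -- present; the other bits are clear.
  | 0, m => m = 4 ^ k - 1
  | a + 1, m' => ∃ m j, Reach n k b a m ∧ Edge n k b a m j m'

theorem four_pow_le (k : ℕ) : 4 ^ k ≤ 16 ^ k := Nat.pow_le_pow_left (by norm_num) k

/-- Masks never outgrow `4k` bits: both `m` and `2 ^ j` are at most `16 ^ k`, and the shift halves
their sum. -/
theorem Reach.lt {n k : ℕ} {b : ℕ → ℕ → ℕ} {a m : ℕ} (h : Reach n k b a m) : m < 16 ^ k := by
  induction a generalizing m with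
  | zero =>
    have := four_pow_le k
    have h0 : 0 < 4 ^ k := by positivity
    have : m = 4 ^ k - 1 := h
    omega
  | succ a ih =>
    obtain ⟨m₀, j, h1, h2⟩ := h
    have h3 := ih h1
    have h4 : 2 ^ j ≤ 16 ^ k := by
      calc 2 ^ j ≤ 2 ^ (4 * k) := Nat.pow_le_pow_right (by norm_num) h2.le
        _ = 16 ^ k := by rw [pow_mul]; norm_num
    have := h2.eq
    omega

theorem prefixSet_zero (n k : ℕ) : prefixSet n k 0 (4 ^ k - 1) = ∅ := by
  have : 4 ^ k = 2 ^ (2 * k) := by rw [pow_mul]; norm_num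
  ext p
  simp [mem_prefixSet, this, Nat.testBit_two_pow_sub_one]

/-- Each edge adds a vertex whose bit was clear, so the vertices added along a chain are pairwise
distinct. -/
theorem prefixSet_eq_image {n k : ℕ} {b : ℕ → ℕ → ℕ} {μ j : ℕ → ℕ} (h0 : μ 0 = 4 ^ k - 1)
    (step : ∀ i < n, Edge n k b i (μ i) (j i) (μ (i + 1))) (a : ℕ) (ha : a ≤ n) :
    prefixSet n k a (μ a) = (range a).image (fun i => i + j i - 2 * k) ∧
      Set.InjOn (fun i => i + j i - 2 * k) (range a : Finset ℕ) := by
  induction a with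
  | zero => simp [h0, prefixSet_zero]
  | succ a ih =>
    obtain ⟨h1, h2⟩ := ih (by omega)
    have h3 := step a (by omega)
    have h4 := notMem_prefixSet (n := n) h3.bit h3.lo
    constructor
    · rw [prefixSet_succ h3.bit h3.eq h3.lo h3.hi, h1, range_add_one, image_insert]
    · rw [range_add_one, coe_insert, Set.injOn_insert (by simp)]
      refine ⟨h2, ?_⟩
      rw [h1] at h4
      simpa using h4

/-- When every number is within `2k` of its position, windows of `4k` bits lose nothing, and the
prefixes of the ordering form a chain of edges. -/
theorem Reach.of_numbering {n k : ℕ} {b : ℕ → ℕ → ℕ} {pos c : ℕ → ℕ} (hn : IsNumbering n pos c)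
    (h1 : ∀ p < n, pos p ≤ p + 2 * k) (h2 : ∀ p < n, p ≤ pos p + 2 * k)
    (hcut : ∀ a ≤ n, cut n b ((range n).filter fun p => pos p < a) ≤ k) :
    Reach n k b n (4 ^ k - 1) := by
  obtain ⟨μ, hμ⟩ : ∃ μ : ℕ → ℕ, ∀ a ≤ n, ∀ i, (μ a).testBit i =
      decide (a + i < 2 * k ∨ (a + i - 2 * k < n ∧ pos (a + i - 2 * k) < a)) := by
    -- Bit `i` stands for `a + i - 2 * k`, and the case `a + i < 2 * k` marks negative numbers as
    -- present. By `h2` all bits from `4 * k` on would be clear anyway.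
    refine ⟨fun a => Nat.ofBits fun i : Fin (4 * k) =>
      decide (a + i < 2 * k ∨ (a + i - 2 * k < n ∧ pos (a + i - 2 * k) < a)), fun a ha i => ?_⟩
    by_cases hi : i < 4 * k
    · rw [Nat.testBit_ofBits_lt _ _ hi]
    · rw [Nat.testBit_ofBits_ge _ _ (by omega)]
      symm
      rw [decide_eq_false_iff_not]
      rintro (h | ⟨h3, h4⟩)
      · omega
      · have := h2 _ h3
        omega
  have hset : ∀ a ≤ n, prefixSet n k a (μ a) = (range n).filter fun p => pos p < a := by
    intro a ha
    ext p
    rw [mem_prefixSet, mem_filter, mem_range, and_congr_right_iff]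
    intro hp
    rcases lt_or_ge (p + 2 * k) a with h | h
    · have := h1 p hp
      exact ⟨fun _ => by omega, fun _ => .inl h⟩
    · rw [hμ a ha, decide_eq_true_eq]
      have e : a + (p + 2 * k - a) = p + 2 * k := by omega
      rw [e, Nat.add_sub_cancel]
      constructor
      · rintro (h3 | h3 | h3)
        · omega
        · omega
        · exact h3.2
      · exact fun h3 => .inr (.inr ⟨hp, h3⟩)
  -- At level `n`, too, exactly the lower `2k` bits are set, namely those of numbers below `n`; so
  -- the first and the last mask agree.
  have hend : ∀ a, a = 0 ∨ a = n → μ a = 4 ^ k - 1 := by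
    intro a ha
    have : 4 ^ k = 2 ^ (2 * k) := by rw [pow_mul]; norm_num
    refine Nat.eq_of_testBit_eq fun i => ?_
    rw [this, Nat.testBit_two_pow_sub_one, hμ a (by omega), decide_eq_decide]
    rcases ha with rfl | rfl
    · constructor
      · rintro (h | h) <;> omega
      · intro h; left; omega
    · constructor
      · rintro (h | h) <;> omega
      · intro h
        by_cases h3 : a + i < 2 * k
        · exact .inl h3
        · exact .inr ⟨by omega, hn.pos_lt _ (by omega)⟩
  have hr : ∀ a ≤ n, Reach n k b a (μ a) := by
    intro a
    induction a with
    | zero => exact fun _ => hend 0 (.inl rfl)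
    | succ a ih =>
      intro ha
      have hc := hn.lt a (by omega)
      have hpc := hn.right_inv a (by omega)
      have h3 := h1 _ hc
      have h4 := h2 _ hc
      rw [hpc] at h3 h4
      have hbit : (μ a).testBit (c a + 2 * k - a) = false := by
        rw [hμ a (by omega), decide_eq_false_iff_not]
        have e : a + (c a + 2 * k - a) = c a + 2 * k := by omega
        rw [e, Nat.add_sub_cancel, hpc]
        omega
      have hpos : ∀ p < n, pos p = a ↔ p = c a := fun p hp =>
        ⟨fun h => by rw [← h, hn.left_inv p hp], fun h => by rw [h, hpc]⟩
      refine ⟨μ a, c a + 2 * k - a, ih (by omega), hbit, ?_, by omega, by omega, by omega, ?_⟩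
      · refine Nat.eq_of_testBit_eq fun i => ?_
        rw [testBit_add_two_pow hbit, hμ a (by omega)]
        cases i with
        | zero =>
          have : (2 * μ (a + 1) + 1).testBit 0 = true := by simp
          rw [this]
          symm
          rw [Bool.or_eq_true, decide_eq_true_eq, decide_eq_true_eq]
          by_cases h5 : a + 0 < 2 * k
          · exact .inl (.inl h5)
          · have h6 := h1 (a + 0 - 2 * k) (by omega)
            have h7 := hpos (a + 0 - 2 * k) (by omega)
            by_cases h8 : pos (a + 0 - 2 * k) = a
            · have := h7.1 h8
              right; omega
            · left; right; omega
        | succ i =>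
          have e2 : (2 * μ (a + 1) + 1) / 2 = μ (a + 1) := by omega
          rw [Nat.testBit_succ, e2, hμ (a + 1) ha, Bool.eq_iff_iff, Bool.or_eq_true,
            decide_eq_true_eq, decide_eq_true_eq, decide_eq_true_eq]
          have e : a + 1 + i = a + (i + 1) := by omega
          rw [e]
          by_cases h5 : a + (i + 1) < 2 * k
          · simp [h5]
          by_cases h6 : a + (i + 1) - 2 * k < n
          · have h7 := hpos _ h6
            constructor
            · rintro (h | ⟨-, h⟩)
              · omega
              · by_cases h8 : pos (a + (i + 1) - 2 * k) = a
                · have := h7.1 h8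
                  right; omega
                · left; right; omega
            · rintro ((h | ⟨-, h⟩) | h)
              · omega
              · right; omega
              · right
                have := h7.2 (by omega)
                omega
          · constructor
            · rintro (h | h) <;> omega
            · rintro ((h | h) | h) <;> omega
      · rw [hset _ ha]; exact hcut _ ha
  have := hr n le_rfl
  rwa [hend n (.inr rfl)] at this

/-! #### Degrees -/

/-- The out-degree of `v`. -/
def outdeg (n : ℕ) (A : ℕ → ℕ → ℕ) (v : ℕ) : ℕ := ∑ u ∈ range n, A v u

/-- A number that orders the vertices by out-degree, and by name among equal out-degrees. -/
def key (n : ℕ) (A : ℕ → ℕ → ℕ) (v : ℕ) : ℕ := outdeg n A v * n + v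

/-- The position of `v` in the ordering by `key`. -/
def rank (n : ℕ) (A : ℕ → ℕ → ℕ) (v : ℕ) : ℕ :=
  ((range n).filter fun u => key n A u < key n A v).card

section

variable {n k : ℕ} {A : ℕ → ℕ → ℕ} {pos c : ℕ → ℕ}

theorem key_lt_of_outdeg_lt {u v : ℕ} (hu : u < n) (h : outdeg n A u < outdeg n A v) :
    key n A u < key n A v := by
  unfold key
  have : (outdeg n A u + 1) * n ≤ outdeg n A v * n := Nat.mul_le_mul_right _ h
  rw [add_mul] at this
  omega

theorem key_injective {u v : ℕ} (hu : u < n) (hv : v < n) (h : key n A u = key n A v) :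
    u = v := by
  rcases lt_trichotomy (outdeg n A u) (outdeg n A v) with h1 | h1 | h1
  · exact absurd h (key_lt_of_outdeg_lt hu h1).ne
  · unfold key at h
    rw [h1] at h
    omega
  · exact absurd h (key_lt_of_outdeg_lt hv h1).ne'

theorem rank_lt {v : ℕ} (hv : v < n) : rank n A v < n := by
  have : ((range n).filter fun u => key n A u < key n A v).card < (range n).card :=
    card_lt_card (filter_ssubset.2 ⟨v, by simpa using hv, by simp⟩)
  simpa [rank] using this

theorem rank_lt_rank {u v : ℕ} (hu : u < n) (h : key n A u < key n A v) :
    rank n A u < rank n A v := by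
  refine card_lt_card ⟨fun x hx => ?_, fun hs => ?_⟩
  · simp only [mem_filter] at hx ⊢
    exact ⟨hx.1, hx.2.trans h⟩
  · have : u ∈ (range n).filter fun x => key n A x < key n A u := hs (by simp [hu, h])
    simp at this

theorem rank_injOn : Set.InjOn (rank n A) (range n : Finset ℕ) := by
  intro u hu v hv h
  simp only [coe_range, Set.mem_Iio] at hu hv
  rcases lt_trichotomy (key n A u) (key n A v) with h1 | h1 | h1
  · exact absurd h (rank_lt_rank hu h1).ne
  · exact key_injective hu hv h1
  · exact absurd h (rank_lt_rank hv h1).ne'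

theorem exists_isNumbering_rank (n : ℕ) (A : ℕ → ℕ → ℕ) :
    ∃ σ, IsNumbering n (rank n A) σ := by
  have hs : Set.SurjOn (rank n A) (range n : Finset ℕ) (range n : Finset ℕ) :=
    surjOn_of_injOn_of_card_le _ (fun v hv => by simpa using rank_lt (by simpa using hv))
      rank_injOn le_rfl
  refine ⟨Function.invFunOn (rank n A) (range n : Finset ℕ), fun v hv => rank_lt hv,
    fun i hi => ?_, fun v hv => ?_, fun i hi => ?_⟩
  · simpa using Function.invFunOn_mem (hs (by simpa using hi))
  · exact rank_injOn.leftInvOn_invFunOn (by simpa using hv)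
  · exact Function.invFunOn_eq (hs (by simpa using hi))

theorem card_filter_pos_lt (hn : IsNumbering n pos c) {a : ℕ} (ha : a ≤ n) :
    ((range n).filter fun u => pos u < a).card = a := by
  conv_rhs => rw [← card_range a]
  refine card_nbij' pos c ?_ ?_ ?_ ?_
  · intro u hu; simpa using (mem_filter.1 hu).2
  · intro i hi
    have hi' : i < a := by simpa using hi
    simp [hn.lt i (by omega), hn.right_inv i (by omega), hi']
  · intro u hu; exact hn.left_inv u (by simpa using (mem_filter.1 hu).1)
  · intro i hi; exact hn.right_inv i (by have : i < a := by simpa using hi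
                                         omega)

/-- An out-neighbour of `v` is one of the `pos v` earlier vertices or is reached by an arc across
the cut just after `v`. -/
theorem outdeg_le (hn : IsNumbering n pos c) (hA : ∀ u v, A u v ≤ 1)
    (hA0 : ∀ v < n, A v v = 0)
    (hcut : ∀ a ≤ n, cut n A ((range n).filter fun p => pos p < a) ≤ k) {v : ℕ} (hv : v < n) :
    outdeg n A v ≤ pos v + k := by
  have hp := hn.pos_lt v hv
  have h1 := hcut (pos v + 1) hp
  have h2 : ∑ u ∈ range n \ (range n).filter (fun p => pos p < pos v + 1), A v u ≤ k := by
    refine le_trans ?_ h1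
    exact single_le_sum (f := fun p => ∑ u ∈ range n \ (range n).filter
      (fun p => pos p < pos v + 1), A p u) (fun _ _ => Nat.zero_le _) (by simp [hv])
  have h3 : ∑ u ∈ (range n).filter (fun p => pos p < pos v + 1), A v u ≤ pos v := by
    have hm : v ∈ (range n).filter (fun p => pos p < pos v + 1) := by simp [hv]
    rw [← sum_erase_add _ _ hm, hA0 v hv, add_zero]
    refine (sum_le_card_nsmul _ _ 1 fun u _ => hA v u).trans ?_
    rw [card_erase_of_mem hm, card_filter_pos_lt hn hp]
    simp
  have h4 := sum_sdiff (f := A v) (filter_subset (fun p => pos p < pos v + 1) (range n))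
  unfold outdeg
  omega

/-- Every vertex before `v` is an out-neighbour of `v` or sends an arc to `v`, and arcs of the
second kind cross the cut just before `v`. This is where semi-completeness enters. -/
theorem le_outdeg (hn : IsNumbering n pos c)
    (hs : ∀ u < n, ∀ v < n, u ≠ v → 1 ≤ A u v + A v u)
    (hcut : ∀ a ≤ n, cut n A ((range n).filter fun p => pos p < a) ≤ k) {v : ℕ} (hv : v < n) :
    pos v ≤ outdeg n A v + k := by
  have hp := hn.pos_lt v hv
  have h2 : ∑ u ∈ (range n).filter (fun p => pos p < pos v), A u v ≤ k := by
    refine le_trans ?_ (hcut (pos v) hp.le)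
    exact sum_le_sum fun u _ => single_le_sum (f := A u) (fun _ _ => Nat.zero_le _)
      (by simp [hv])
  have h3 : ∑ u ∈ (range n).filter (fun p => pos p < pos v), A v u ≤ outdeg n A v :=
    sum_le_sum_of_subset (filter_subset _ _)
  have h4 : ((range n).filter fun p => pos p < pos v).card • 1 ≤
      ∑ u ∈ (range n).filter (fun p => pos p < pos v), (A v u + A u v) := by
    refine card_nsmul_le_sum _ _ _ fun u hu => ?_
    simp only [mem_filter, mem_range] at hu
    exact hs v hv u hu.1 fun h => by rw [h] at hu; omega
  rw [card_filter_pos_lt hn hp.le, sum_add_distrib] at h4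
  simp only [smul_eq_mul, mul_one] at h4
  omega

/-- A vertex `u` with smaller key has no larger out-degree, hence `pos u ≤ pos v + 2 * k`. Excluding
`pos v` itself saves the last unit. -/
theorem rank_le (hn : IsNumbering n pos c) (h1 : ∀ v < n, outdeg n A v ≤ pos v + k)
    (h2 : ∀ v < n, pos v ≤ outdeg n A v + k) {v : ℕ} (hv : v < n) :
    rank n A v ≤ pos v + 2 * k := by
  have h3 : ∀ u ∈ (range n).filter (fun u => key n A u < key n A v),
      pos u ∈ (range (pos v + 2 * k + 1)).erase (pos v) := by
    intro u hu
    simp only [mem_filter, mem_range] at hu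
    have hd : outdeg n A u ≤ outdeg n A v := by
      by_contra h
      exact absurd (key_lt_of_outdeg_lt hv (not_le.1 h)) (by omega)
    have := h1 v hv
    have := h2 u hu.1
    rw [mem_erase, mem_range]
    refine ⟨fun h => ?_, by omega⟩
    have : u = v := by rw [← hn.left_inv u hu.1, h, hn.left_inv v hv]
    rw [this] at hu
    omega
  have h4 := card_le_card_of_injOn pos h3 (fun x hx y hy h => by
    simp only [coe_filter, mem_range, Set.mem_ofPred_eq] at hx hy
    rw [← hn.left_inv x hx.1, h, hn.left_inv y hy.1])
  rw [card_erase_of_mem (by simp)] at h4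
  simpa [rank] using h4

/-- Vertices more than `2k` positions before `v` have strictly smaller out-degree, so all of them
are counted by the rank. -/
theorem le_rank (hn : IsNumbering n pos c) (h1 : ∀ v < n, outdeg n A v ≤ pos v + k)
    (h2 : ∀ v < n, pos v ≤ outdeg n A v + k) {v : ℕ} (hv : v < n) :
    pos v ≤ rank n A v + 2 * k := by
  have hp := hn.pos_lt v hv
  have h3 : ∀ i ∈ range (pos v - 2 * k),
      c i ∈ (range n).filter (fun u => key n A u < key n A v) := by
    intro i hi
    rw [mem_range] at hi
    have hc := hn.lt i (by omega)
    have h4 := h1 _ hc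
    rw [hn.right_inv i (by omega)] at h4
    have h5 := h2 v hv
    rw [mem_filter, mem_range]
    exact ⟨hc, key_lt_of_outdeg_lt hc (by omega)⟩
  have h4 := card_le_card_of_injOn c h3 (fun x hx y hy h => by
    simp only [coe_range, Set.mem_Iio] at hx hy
    rw [← hn.right_inv x (by omega), h, hn.right_inv y (by omega)])
  rw [card_range] at h4
  unfold rank
  omega

/-- An ordering of small width is found by the dynamic program on the ordering by degrees. -/
theorem Reach.of_width_le {σ : ℕ → ℕ} (hn : IsNumbering n pos c)
    (hσ : IsNumbering n (rank n A) σ) (hA : ∀ u v, A u v ≤ 1) (hA0 : ∀ v < n, A v v = 0)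
    (hs : ∀ u < n, ∀ v < n, u ≠ v → 1 ≤ A u v + A v u)
    (hcut : ∀ a ≤ n, cut n A ((range n).filter fun p => pos p < a) ≤ k) :
    Reach n k (fun p q => A (σ p) (σ q)) n (4 ^ k - 1) := by
  have h1 : ∀ v < n, outdeg n A v ≤ pos v + k := fun v hv => outdeg_le hn hA hA0 hcut hv
  have h2 : ∀ v < n, pos v ≤ outdeg n A v + k := fun v hv => le_outdeg hn hs hcut hv
  refine Reach.of_numbering (pos := fun p => pos (σ p)) (c := fun i => rank n A (c i))
    ⟨fun p hp => hn.pos_lt _ (hσ.lt p hp), fun i hi => hσ.pos_lt _ (hn.lt i hi),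
      fun p hp => ?_, fun i hi => ?_⟩ (fun p hp => ?_) (fun p hp => ?_) fun a ha => ?_
  · rw [hn.left_inv _ (hσ.lt p hp), hσ.right_inv p hp]
  · rw [hσ.left_inv _ (hn.lt i hi), hn.right_inv i hi]
  · have := le_rank hn h1 h2 (hσ.lt p hp)
    rwa [hσ.right_inv p hp] at this
  · have := rank_le hn h1 h2 (hσ.lt p hp)
    rwa [hσ.right_inv p hp] at this
  · rw [cut_filter_comp hσ fun v => pos v < a]
    exact hcut a ha

end

end CutDP

/-! ### Digraphs on `Fin n` and their adjacency matrices -/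

namespace CutDP

open Finset WordRAM

/-- The adjacency matrix of a digraph, as it is presented to the machine. -/
noncomputable def adj {n : ℕ} (T : Digraph (Fin n)) (u v : ℕ) : ℕ :=
  (inputState T 0).mem (u * n + v)

section

variable {n : ℕ} (T : Digraph (Fin n))

theorem adj_le (u v : ℕ) : adj T u v ≤ 1 := by
  unfold adj inputState
  dsimp only
  split_ifs <;> simp

open Classical in
theorem adj_fin (u v : Fin n) : adj T u v = if T.Adj u v then 1 else 0 := by
  unfold adj inputState
  refine if_congr ⟨?_, fun h => ⟨u, v, rfl, h⟩⟩ rfl rfl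
  rintro ⟨i, j, h, hij⟩
  have hu : u = i := by
    have := congrArg (· / n) h
    have hn : 0 < n := u.pos
    simp only [mul_comm _ n, Nat.mul_add_div hn, Nat.div_eq_of_lt v.2, Nat.div_eq_of_lt j.2] at this
    exact Fin.ext (by omega)
  subst hu
  have : v = j := Fin.ext (by omega)
  rwa [this]

theorem adj_self (hT : T.IsSemicomplete) (v : ℕ) (hv : v < n) : adj T v v = 0 := by
  rw [adj_fin T ⟨v, hv⟩ ⟨v, hv⟩, if_neg (hT.1 _)]

theorem one_le_adj_add_adj (hT : T.IsSemicomplete) (u : ℕ) (hu : u < n) (v : ℕ) (hv : v < n)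
    (h : u ≠ v) : 1 ≤ adj T u v + adj T v u := by
  have h1 := adj_fin T ⟨u, hu⟩ ⟨v, hv⟩
  have h2 := adj_fin T ⟨v, hv⟩ ⟨u, hu⟩
  rcases hT.2 ⟨u, hu⟩ ⟨v, hv⟩ (by simpa using h) with h3 | h3
  · rw [if_pos h3] at h1
    simp only at h1
    omega
  · rw [if_pos h3] at h2
    simp only at h2
    omega

theorem ncard_arcsBetween (P : ℕ → Prop) [DecidablePred P] (Y : Set (Fin n))
    (hY : ∀ v, v ∈ Y ↔ P v) :
    (T.arcsBetween Y Yᶜ).ncard = cut n (adj T) ((range n).filter P) := by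
  classical
  have h1 : T.arcsBetween Y Yᶜ =
      ((univ : Finset (Fin n × Fin n)).filter fun e => T.Adj e.1 e.2 ∧ P e.1 ∧ ¬ P e.2 :
        Finset (Fin n × Fin n)) := by
    ext e
    simp [Digraph.arcsBetween, hY]
  rw [h1, Set.ncard_coe_finset, card_filter, ← univ_product_univ, sum_product]
  unfold cut
  rw [← filter_not, sum_filter, sum_range]
  refine sum_congr rfl fun u _ => ?_
  rw [sum_filter, sum_range]
  by_cases hu : P u
  · rw [if_pos hu]
    refine sum_congr rfl fun v _ => ?_
    rw [adj_fin]
    by_cases hv : P v <;> simp [hu, hv]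
  · simp [hu]

/-- The position of `v` in the ordering `π`. -/
def posOf (π : Fin n ≃ Fin n) (v : ℕ) : ℕ := if h : v < n then π.symm ⟨v, h⟩ else 0

/-- The vertex at position `i` of the ordering `π`. -/
def vertexAt (π : Fin n ≃ Fin n) (i : ℕ) : ℕ := if h : i < n then π ⟨i, h⟩ else 0

theorem isNumbering_posOf (π : Fin n ≃ Fin n) : IsNumbering n (posOf π) (vertexAt π) where
  pos_lt v hv := by simp [posOf, hv]
  lt i hi := by simp [vertexAt, hi]
  left_inv v hv := by simp [posOf, vertexAt, hv]
  right_inv v hv := by simp [posOf, vertexAt, hv]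

theorem orderingWidth_le_iff (π : Fin n ≃ Fin n) (k : ℕ) : T.orderingWidth π ≤ k ↔
    ∀ a ≤ n, cut n (adj T) ((range n).filter fun v => posOf π v < a) ≤ k := by
  unfold Digraph.orderingWidth
  rw [Finset.sup_le_iff]
  refine forall_congr' fun a => ?_
  rw [mem_range, Nat.lt_succ_iff, ncard_arcsBetween T fun v => posOf π v < a]
  intro v
  simp [Digraph.orderingPrefix, posOf]

theorem exists_orderingWidth_le {k : ℕ} (h : T.cutwidth ≤ k) :
    ∃ π : Fin n ≃ Fin n, T.orderingWidth π ≤ k := by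
  have hne : {m | ∃ (l : ℕ) (π : Fin l ≃ Fin n), T.orderingWidth π = m}.Nonempty :=
    ⟨_, n, Equiv.refl _, rfl⟩
  obtain ⟨l, π, hπ⟩ := Nat.sInf_mem hne
  -- `Digraph.cutwidth` leaves the length of the ordering free; the bijection forces it to be `n`.
  obtain rfl : l = n := by simpa using Fintype.card_congr π
  exact ⟨π, hπ.trans_le h⟩

theorem reach_of_cutwidth_le (hT : T.IsSemicomplete) {k : ℕ} (h : T.cutwidth ≤ k) {σ : ℕ → ℕ}
    (hσ : IsNumbering n (rank n (adj T)) σ) :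
    Reach n k (fun p q => adj T (σ p) (σ q)) n (4 ^ k - 1) := by
  obtain ⟨π, hπ⟩ := exists_orderingWidth_le T h
  exact Reach.of_width_le (isNumbering_posOf π) hσ (adj_le T) (adj_self T hT)
    (one_le_adj_add_adj T hT) ((orderingWidth_le_iff T π k).1 hπ)

/-- Soundness, valid for any numbering: a chain adds `n` distinct vertices, hence all of them, and
the prefixes of the resulting ordering are the encoded sets, whose cuts were bounded edge by edge.
-/
theorem exists_ordering_of_edges {k : ℕ} {r σ μ j : ℕ → ℕ} (hσ : IsNumbering n r σ)
    (h0 : μ 0 = 4 ^ k - 1)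
    (step : ∀ i < n, Edge n k (fun p q => adj T (σ p) (σ q)) i (μ i) (j i) (μ (i + 1))) :
    ∃ π : Fin n ≃ Fin n, T.orderingWidth π ≤ k ∧
      ∀ i : Fin n, (π i : ℕ) = σ (i + j i - 2 * k) := by
  have hlt : ∀ i < n, i + j i - 2 * k < n := fun i hi => by
    have := (step i hi).lo
    have := (step i hi).hi
    omega
  have hinj := (prefixSet_eq_image h0 step n le_rfl).2
  let f : Fin n → Fin n := fun i => ⟨σ (i + j i - 2 * k), hσ.lt _ (hlt i i.2)⟩
  have hf : Function.Injective f := by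
    intro x y hxy
    have h1 : σ (x + j x - 2 * k) = σ (y + j y - 2 * k) := congrArg Fin.val hxy
    have h2 : (x : ℕ) + j x - 2 * k = y + j y - 2 * k := by
      rw [← hσ.right_inv _ (hlt x x.2), h1, hσ.right_inv _ (hlt y y.2)]
    exact Fin.ext (hinj (by simp) (by simp) h2)
  let π : Fin n ≃ Fin n := Equiv.ofBijective f (Finite.injective_iff_bijective.1 hf)
  refine ⟨π, (orderingWidth_le_iff T π k).2 fun a ha => ?_, fun i => rfl⟩
  have hv : ∀ i < n, vertexAt π i = σ (i + j i - 2 * k) := fun i hi => by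
    simp only [vertexAt, hi, dif_pos]; rfl
  have hc := cut_filter_comp (A := adj T) hσ fun v => posOf π v < a
  have hset : ((range n).filter fun p => posOf π (σ p) < a) = prefixSet n k a (μ a) := by
    rw [(prefixSet_eq_image h0 step a ha).1]
    ext p
    simp only [mem_filter, mem_range, mem_image]
    constructor
    · rintro ⟨hp, h⟩
      refine ⟨posOf π (σ p), h, ?_⟩
      have h3 := (isNumbering_posOf π).left_inv _ (hσ.lt p hp)
      have h4 := (isNumbering_posOf π).pos_lt _ (hσ.lt p hp)
      rw [hv _ h4] at h3
      rw [← hσ.right_inv _ (hlt _ h4), h3, hσ.right_inv _ hp]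
    · rintro ⟨i, hi, rfl⟩
      refine ⟨hlt i (by omega), ?_⟩
      rw [← hv i (by omega), (isNumbering_posOf π).right_inv i (by omega)]
      exact hi
  rw [← hc, hset]
  rcases a with _ | a
  · rw [h0, prefixSet_zero]; simp [cut]
  · exact (step a ha).cut_le

end

end CutDP

/-! ### The program -/

namespace CutDP

open Finset WordRAM

/-! Registers: `0`: number `n` of vertices; `1`: `k`; `2`, `3`: loop counters; `4`: accumulator;
`5`: `n * n`; `6`: `16 ^ k`; `7`: `4 ^ k - 1`; `8`: `4 * k + 1`; `9`: start of the table;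
`10`: level; `11`: mask to be reached; `12`: number of a bit; `13`: remaining bits;
`14`: power of two; `15`: previous mask; `16`: added vertex; `17`: table entry; `18`: position;
`19`: remaining bits of the previous mask; `20`, `21`: arcs from and to the added vertex;
`22`: vertex; `23`: `2 * k`; `24`: bit. -/

/-- The loop body that updates the numbers of arcs from the new vertex to the vertices outside the
prefix and to the new vertex from those inside. -/
def scanBody : Program :=
  22 ::= .load (.reg 5 + .reg 18) ;;
  -- Positions below the window are present by convention; bits are consumed only from the start of
  -- the window on.
  .ite (.reg 10 - (.reg 18 + .reg 23)) (24 ::= 1)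
    (24 ::= .reg 19 - .reg 19 / 2 * 2 ;; 19 ::= .reg 19 / 2) ;;
  20 ::= .reg 20 + (1 - .reg 24) * .load (.reg 16 * .reg 0 + .reg 22) ;;
  21 ::= .reg 21 + .reg 24 * .load (.reg 22 * .reg 0 + .reg 16)

/-- Find the numbers of arcs from and to the new vertex. -/
def scan : Program := .forLoop 18 0 scanBody

/-- The word size suffices for all intermediate results. -/
structure Fit (n k w : ℕ) : Prop where
  mul : 16 ^ k * ((n + 4 * k + 17) * (n + 4 * k + 17)) < 2 ^ w
  table : n * n + 2 * n + (n + 3) * 16 ^ k + 100 < 2 ^ w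
  entry : (k + 1) * (4 * k + 2) + n + 100 < 2 ^ w

theorem Fit.ne_zero {n k w : ℕ} (h : Fit n k w) : w ≠ 0 := by
  rintro rfl
  have := h.table
  simp at this

/-- The memory contains the adjacency matrix `A` and the sorted list `σ` of vertices. -/
structure Sorted (n : ℕ) (A : ℕ → ℕ → ℕ) (σ mem : ℕ → ℕ) : Prop where
  mat : ∀ u < n, ∀ v < n, mem (u * n + v) = A u v
  list : ∀ p < n, mem (n * n + p) = σ p
  lt : ∀ p < n, σ p < n
  le_one : ∀ u v, A u v ≤ 1

theorem mul_add_lt {u v n : ℕ} (hu : u < n) (hv : v < n) : u * n + v < n * n := by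
  have : (u + 1) * n ≤ n * n := Nat.mul_le_mul_right _ hu
  rw [add_mul] at this
  omega

theorem sum_range_ite (n : ℕ) (P : ℕ → Prop) [DecidablePred P] (f : ℕ → ℕ) :
    ∑ q ∈ range n, (if P q then 1 else 0) * f q = ∑ q ∈ (range n).filter P, f q := by
  rw [sum_filter]
  exact sum_congr rfl fun q _ => by split_ifs <;> simp

/-- For `a < 2 * k` the window begins at a negative number, so register `19` has to arrive with
those `2 * k - a` bits shifted out. -/
theorem within_scan {n k w a m P : ℕ} {A : ℕ → ℕ → ℕ} {σ : ℕ → ℕ} {s₀ : State}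
    (hw : Fit n k w) (hmem : Sorted n A σ s₀.mem) (hP : P < n) (ha : a ≤ n) (hm : m < 16 ^ k)
    (h0 : s₀.reg 0 = n) (h5 : s₀.reg 5 = n * n) (h10 : s₀.reg 10 = a) (h16 : s₀.reg 16 = P)
    (h19 : s₀.reg 19 = m / 2 ^ (2 * k - a)) (h20 : s₀.reg 20 = 0) (h21 : s₀.reg 21 = 0)
    (h23 : s₀.reg 23 = 2 * k) :
    Within w scan s₀ (n * 100 + 6) fun s' =>
      s'.reg 20 = ∑ q ∈ range n \ prefixSet n k a m, A P (σ q) ∧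
      s'.reg 21 = ∑ q ∈ prefixSet n k a m, A (σ q) P := by
  have hw1 := hw.table
  have hw2 := hw.entry
  have hw0 := hw.ne_zero
  have hMn : 16 ^ k ≤ (n + 3) * 16 ^ k := Nat.le_mul_of_pos_left _ (by omega)
  have hk : k ≤ (k + 1) * (4 * k + 2) := by nlinarith
  have hk4 : 4 * k ≤ (k + 1) * (4 * k + 2) := by nlinarith
  let χ : ℕ → ℕ := fun q => if q + 2 * k < a ∨ m.testBit (q + 2 * k - a) = true then 1 else 0
  have hχ : ∀ q, χ q ≤ 1 := fun q => by
    by_cases h : q + 2 * k < a ∨ m.testBit (q + 2 * k - a) = true <;> simp [χ, h]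
  have hsum : ∀ (f g : ℕ → ℕ) (i : ℕ), i < n → (∀ q, f q ≤ 1) → (∀ q, g q ≤ 1) →
      ∑ q ∈ range i, f q * g q ≤ n := by
    intro f g i hi hf hg
    refine (sum_le_card_nsmul _ _ 1 fun q _ => ?_).trans (by simpa using hi.le)
    exact Nat.mul_le_mul (hf q) (hg q)
  have key : Within w scan s₀ (n * (92 + 8) + 6) fun s' =>
      s'.reg 19 = m / 2 ^ (n + 2 * k - a) ∧
      s'.reg 20 = ∑ q ∈ range n, (1 - χ q) * A P (σ q) ∧
      s'.reg 21 = ∑ q ∈ range n, χ q * A (σ q) P := by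
    -- Truncated subtraction covers both phases: the exponent stays `0` as long as `i + 2 * k ≤ a`.
    refine Within.forLoop_frame (fun i s => s.reg 19 = m / 2 ^ (i + 2 * k - a) ∧
      s.reg 20 = ∑ q ∈ range i, (1 - χ q) * A P (σ q) ∧
      s.reg 21 = ∑ q ∈ range i, χ q * A (σ q) P) (by omega) (by decide) (by decide) (by decide)
      h0 (by simp [h19, h20, h21]) ?_
    rintro i hi s ⟨i19, i20, i21⟩ i18 hf hmem'
    have e0 := (hf 0 (by decide)).trans h0
    have e5 := (hf 5 (by decide)).trans h5
    have e10 := (hf 10 (by decide)).trans h10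
    have e16 := (hf 16 (by decide)).trans h16
    have e23 := (hf 23 (by decide)).trans h23
    have emem := hmem' (by simp [scanBody, Program.Storeless])
    have m1 := hmem.list i hi
    have l3 := hmem.lt i hi
    have m2 := hmem.mat P hP (σ i) l3
    have m3 := hmem.mat (σ i) l3 P hP
    have l1 := mul_add_lt hP l3
    have l2 := mul_add_lt l3 hP
    have A1 := hmem.le_one P (σ i)
    have A2 := hmem.le_one (σ i) P
    have hz : m / 2 ^ (i + 2 * k - a) ≤ m := Nat.div_le_self _ _
    have s1 := hsum (fun q => 1 - χ q) (fun q => A P (σ q)) i hi (fun q => Nat.sub_le _ _)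
      (fun q => hmem.le_one _ _)
    have s2 := hsum χ (fun q => A (σ q) P) i hi hχ (fun q => hmem.le_one _ _)
    have p1 : (1 - χ i) * A P (σ i) ≤ 1 * 1 := Nat.mul_le_mul (Nat.sub_le _ _) A1
    have p2 : χ i * A (σ i) P ≤ 1 * 1 := Nat.mul_le_mul (hχ i) A2
    have hχi := hχ i
    rw [← emem] at m1 m2 m3
    refine Within.assign_seq ?_ (by decide) ?_
    · simp only [Expr.fits_load, Expr.fits_hAdd, Expr.fits_reg, Expr.eval_hAdd, Expr.eval_reg,
        e5, i18, m1]
      omega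
    have hite : Within w (.ite (.reg 10 - (.reg 18 + .reg 23)) (24 ::= 1)
        (24 ::= .reg 19 - .reg 19 / 2 * 2 ;; 19 ::= .reg 19 / 2)) (s.setReg 22 (σ i)) 24
        fun s' => s'.reg 24 = χ i ∧ s'.reg 19 = m / 2 ^ (i + 1 + 2 * k - a) := by
      refine Within.ite ?_ (by decide) (fun h => ?_) (fun h => ?_)
      · simp [e10, i18, e23]
        omega
      · simp [e10, i18, e23] at h
        refine Within.assign ?_ ?_ (by decide)
        · simp; omega
        · have h1 : i + 2 * k - a = i + 1 + 2 * k - a := by omega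
          have h2 : i + 2 * k < a := by omega
          simp [χ, i19, h1, h2]
      · simp [e10, i18, e23] at h
        refine Within.assign_seq ?_ (by decide) (Within.assign ?_ ?_ (by decide))
        · simp [i19]; omega
        · simp [i19]; omega
        · have h1 : i + 1 + 2 * k - a = i + 2 * k - a + 1 := by omega
          have h2 : ¬ i + 2 * k < a := by omega
          simp only [State.reg_setReg, Expr.eval_reg, Expr.eval_hSub, Expr.eval_hMul,
            Expr.eval_hDiv, Expr.eval_ofNat, i19, h1, pow_succ, χ,
            h2, false_or, Nat.testBit_eq_decide_div_mod_eq]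
          simp only [← Nat.div_div_eq_div_mul]
          simp
          split_ifs <;> omega
    have e22 : (Expr.load (.reg 5 + .reg 18)).eval s = σ i := by simp [e5, i18, m1]
    rw [e22]
    refine Within.seq (hite.frame_mem (by simp [Program.Storeless]) |>.mono le_rfl ?_)
      (by decide)
    rintro s' ⟨⟨j24, j19⟩, hf', hm'⟩
    rw [State.mem_setReg] at hm'
    have j0 : s'.reg 0 = n := by rw [hf' 0 (by decide)]; simp [e0]
    have j16 : s'.reg 16 = P := by rw [hf' 16 (by decide)]; simp [e16]
    have j20 : s'.reg 20 = s.reg 20 := by rw [hf' 20 (by decide)]; simp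
    have j21 : s'.reg 21 = s.reg 21 := by rw [hf' 21 (by decide)]; simp
    have j22 : s'.reg 22 = σ i := by rw [hf' 22 (by decide)]; simp
    rw [i20] at j20
    rw [i21] at j21
    refine Within.assign_seq ?_ (by decide) (Within.assign ?_ ?_ (by decide))
    · simp [j20, j24, j16, j0, j22, hm', m2]
      omega
    · simp [j21, j24, j16, j0, j22, hm', m3]
      omega
    · simp [j19, j20, j21, j24, j16, j0, j22, hm', m2, m3, sum_range_succ]
  refine key.mono le_rfl fun s' h => ⟨h.2.1.trans ?_, h.2.2.trans ?_⟩
  · have h1 : range n \ prefixSet n k a m = (range n).filter fun q =>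
        ¬ (q + 2 * k < a ∨ m.testBit (q + 2 * k - a) = true) := by rw [prefixSet, filter_not]
    rw [h1, ← sum_range_ite]
    refine sum_congr rfl fun q _ => ?_
    by_cases h : q + 2 * k < a ∨ m.testBit (q + 2 * k - a) = true <;> simp only [χ, h] <;> simp
  · exact sum_range_ite n _ _

end CutDP

/-! ### Table entries and a single transition -/

namespace CutDP

open Finset WordRAM

/-- `v` is the table entry for the mask `m'` at level `a + 1` after the bits below `J` have been
tried. -/
def Cell (n k : ℕ) (b : ℕ → ℕ → ℕ) (a m' J v : ℕ) : Prop :=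
  (v = 0 ∧ ∀ m j, j < J → Reach n k b a m → ¬ Edge n k b a m j m') ∨
  ∃ m j, j < J ∧ Reach n k b a m ∧ Edge n k b a m j m' ∧
    v = 1 + cut n b (prefixSet n k (a + 1) m') + (k + 1) * j

/-- `v` is the table entry for the mask `m` at level `a`: it is zero if `m` is not reachable, and
otherwise it encodes the size of the cut and the bit of the last vertex. -/
def Entry (n k : ℕ) (b : ℕ → ℕ → ℕ) : ℕ → ℕ → ℕ → Prop
  | 0, m, v => v = if m = 4 ^ k - 1 then 1 else 0
  | a + 1, m, v => Cell n k b a m (4 * k + 1) v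

section

variable {n k a m J v : ℕ} {b : ℕ → ℕ → ℕ}

theorem Entry.ne_zero_iff (h : Entry n k b a m v) : v ≠ 0 ↔ Reach n k b a m := by
  cases a with
  | zero =>
    have h : v = if m = 4 ^ k - 1 then 1 else 0 := h
    have h2 : Reach n k b 0 m ↔ m = 4 ^ k - 1 := Iff.rfl
    rw [h2, h]
    split_ifs with h3 <;> simp [h3]
  | succ a =>
    rcases h with ⟨rfl, h⟩ | ⟨m₀, j, hj, h1, h2, rfl⟩
    · simp only [ne_eq, not_true_eq_false, false_iff]
      rintro ⟨m₀, j, h1, h2⟩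
      exact h m₀ j (by have := h2.le; omega) h1 h2
    · exact ⟨fun _ => ⟨m₀, j, h1, h2⟩, fun _ => by omega⟩

/-- As `c ≤ k`, the pair `(c, j)` is recovered by division by `k + 1`; the extra `1` keeps a valid
entry apart from an empty one. -/
theorem one_add_cut_sub_one (c : ℕ) (hc : c ≤ k) (j : ℕ) :
    (1 + c + (k + 1) * j - 1) % (k + 1) = c ∧ (1 + c + (k + 1) * j - 1) / (k + 1) = j := by
  have : 1 + c + (k + 1) * j - 1 = c + (k + 1) * j := by omega
  rw [this]
  constructor
  · rw [Nat.add_mul_mod_self_left, Nat.mod_eq_of_lt (by omega)]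
  · rw [Nat.add_mul_div_left _ _ (by omega), Nat.div_eq_of_lt (by omega), zero_add]

/-- The cut depends on the mask alone, so it is irrelevant which of several predecessors wrote the
entry last. -/
theorem Entry.cut_eq (h : Entry n k b a m v) (hv : v ≠ 0) :
    (v - 1) % (k + 1) = cut n b (prefixSet n k a m) ∧ cut n b (prefixSet n k a m) ≤ k := by
  cases a with
  | zero =>
    have h : v = if m = 4 ^ k - 1 then 1 else 0 := h
    by_cases h3 : m = 4 ^ k - 1
    · rw [if_pos h3] at h
      rw [h, h3, prefixSet_zero]
      simp [cut]
    · rw [if_neg h3] at h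
      exact absurd h hv
  | succ a =>
    rcases h with ⟨rfl, h⟩ | ⟨m₀, j, hj, h1, h2, rfl⟩
    · exact absurd rfl hv
    · exact ⟨(one_add_cut_sub_one _ h2.cut_le j).1, h2.cut_le⟩

theorem Entry.edge (h : Entry n k b (a + 1) m v) (hv : v ≠ 0) :
    ∃ m₀, Reach n k b a m₀ ∧ Edge n k b a m₀ ((v - 1) / (k + 1)) m := by
  rcases h with ⟨rfl, h⟩ | ⟨m₀, j, hj, h1, h2, rfl⟩
  · exact absurd rfl hv
  · rw [(one_add_cut_sub_one _ h2.cut_le j).2]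
    exact ⟨m₀, h1, h2⟩

theorem Entry.le (h : Entry n k b a m v) : v ≤ (k + 1) * (4 * k + 1) := by
  cases a with
  | zero =>
    have h : v = if m = 4 ^ k - 1 then 1 else 0 := h
    rw [h]
    split_ifs
    · nlinarith
    · simp
  | succ a =>
    rcases h with ⟨rfl, h⟩ | ⟨m₀, j, hj, h1, h2, rfl⟩
    · simp
    · have h3 := h2.cut_le
      have : (k + 1) * j ≤ (k + 1) * (4 * k) := Nat.mul_le_mul_left _ (by omega)
      rw [mul_add]
      omega

theorem testBit_sub_two_pow {T : ℕ} (h : T.testBit J = true) :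
    (T - 2 ^ J).testBit J = false ∧ T = T - 2 ^ J + 2 ^ J := by
  have h1 := Nat.ge_two_pow_of_testBit h
  have h2 : T = T - 2 ^ J + 2 ^ J := by omega
  refine ⟨?_, h2⟩
  rw [h2, add_comm, Nat.testBit_two_pow_add_eq] at h
  simpa using h

end

/-- The first `X` entries of the table have been computed, and the others are zero. -/
structure Table (n k : ℕ) (b : ℕ → ℕ → ℕ) (X : ℕ) (mem : ℕ → ℕ) : Prop where
  entry : ∀ x < X, Entry n k b (x / 16 ^ k) (x % 16 ^ k) (mem (n * n + 2 * n + x))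
  -- An untouched cell already reads as not reachable, so the table needs no clearing.
  zero : ∀ x, X ≤ x → mem (n * n + 2 * n + x) = 0

theorem Table.update {n k : ℕ} {b : ℕ → ℕ → ℕ} {X v : ℕ} {mem : ℕ → ℕ} (h : Table n k b X mem)
    (hv : Entry n k b (X / 16 ^ k) (X % 16 ^ k) v) :
    Table n k b (X + 1) (Function.update mem (n * n + 2 * n + X) v) where
  entry x hx := by
    by_cases hxX : x = X
    · subst hxX; simpa using hv
    · rw [Function.update_of_ne (by omega)]
      exact h.entry x (by omega)
  zero x hx := by
    rw [Function.update_of_ne (by omega)]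
    exact h.zero x (by omega)

theorem Sorted.update {n : ℕ} {A : ℕ → ℕ → ℕ} {σ mem : ℕ → ℕ} (h : Sorted n A σ mem) (x v : ℕ) :
    Sorted n A σ (Function.update mem (n * n + 2 * n + x) v) where
  mat u hu u' hu' := by
    rw [Function.update_of_ne (by have := mul_add_lt hu hu'; omega)]
    exact h.mat u hu u' hu'
  list p hp := by
    rw [Function.update_of_ne (by omega)]
    exact h.list p hp
  lt := h.lt
  le_one := h.le_one

/-- The registers that do not change after the initialization. -/
structure Consts (n k : ℕ) (s : State) : Prop where
  r0 : s.reg 0 = n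
  r1 : s.reg 1 = k
  r5 : s.reg 5 = n * n
  r6 : s.reg 6 = 16 ^ k
  r7 : s.reg 7 = 4 ^ k - 1
  r8 : s.reg 8 = 4 * k + 1
  r9 : s.reg 9 = n * n + 2 * n
  r23 : s.reg 23 = 2 * k

theorem Consts.congr {n k : ℕ} {s s' : State} (h : Consts n k s) {l : List ℕ}
    (hl : ∀ x ∉ l, s'.reg x = s.reg x)
    (hd : ∀ x ∈ [0, 1, 5, 6, 7, 8, 9, 23], x ∉ l) : Consts n k s' where
  r0 := (hl _ (hd _ (by simp))).trans h.r0
  r1 := (hl _ (hd _ (by simp))).trans h.r1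
  r5 := (hl _ (hd _ (by simp))).trans h.r5
  r6 := (hl _ (hd _ (by simp))).trans h.r6
  r7 := (hl _ (hd _ (by simp))).trans h.r7
  r8 := (hl _ (hd _ (by simp))).trans h.r8
  r9 := (hl _ (hd _ (by simp))).trans h.r9
  r23 := (hl _ (hd _ (by simp))).trans h.r23

/-- Compute the size of the cut after the addition of a vertex and enter it into the table if it is
small. -/
def tryEdge : Program :=
  16 ::= .load (.reg 5 + (.reg 10 + .reg 12 - .reg 23)) ;;
  19 ::= .reg 15 / .reg 25 ;;
  20 ::= 0 ;;
  21 ::= 0 ;;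
  scan ;;
  -- The old cut is decoded as a remainder modulo `k + 1`. The gained arcs are added before the lost
  -- ones are taken off, so truncation never takes effect.
  20 ::= .reg 17 - 1 - (.reg 17 - 1) / (.reg 1 + 1) * (.reg 1 + 1) + .reg 20 - .reg 21 ;;
  .ite (.reg 1 + 1 - .reg 20)
    (.store (.reg 9 + ((.reg 10 + 1) * .reg 6 + .reg 11)) (1 + .reg 20 + (.reg 1 + 1) * .reg 12))
    .skip

theorem within_tryEdge {n k w a m J m' e : ℕ} {A : ℕ → ℕ → ℕ} {σ : ℕ → ℕ} {s : State}
    (hw : Fit n k w) (hmem : Sorted n A σ s.mem) (hA : ∀ v < n, A v v = 0) (hc : Consts n k s)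
    (ha : a < n) (hm : m < 16 ^ k) (hm' : m' < 16 ^ k)
    (h10 : s.reg 10 = a) (h11 : s.reg 11 = m') (h12 : s.reg 12 = J) (h15 : s.reg 15 = m)
    (h17 : s.reg 17 = e) (h25 : s.reg 25 = 2 ^ (2 * k - a))
    (hJ : J ≤ 4 * k) (lo : 2 * k ≤ a + J) (hi : a + J < n + 2 * k)
    (hbit : m.testBit J = false) (heq : 2 * m' + 1 = m + 2 ^ J)
    (he : e ≤ (k + 1) * (4 * k + 1))
    (hcut : (e - 1) % (k + 1) = cut n (fun p q => A (σ p) (σ q)) (prefixSet n k a m)) :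
    Within w tryEdge s (n * 100 + 120) fun s' =>
      let c := cut n (fun p q => A (σ p) (σ q)) (prefixSet n k (a + 1) m')
      (c ≤ k ∧ s'.mem = Function.update s.mem (n * n + 2 * n + ((a + 1) * 16 ^ k + m'))
        (1 + c + (k + 1) * J)) ∨ (k < c ∧ s'.mem = s.mem) := by
  have hw1 := hw.table
  have hw2 := hw.entry
  have hw0 := hw.ne_zero
  have hM1 : (a + 1) * 16 ^ k ≤ n * 16 ^ k := Nat.mul_le_mul_right _ ha
  have hM2 : (n + 3) * 16 ^ k = n * 16 ^ k + 3 * 16 ^ k := by ring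
  have hk1 : (k + 1) * (4 * k + 2) = (k + 1) * (4 * k + 1) + (k + 1) := by ring
  have hk2 : (k + 1) * (4 * k + 1) = (k + 1) * (4 * k) + (k + 1) := by ring
  have hk3 : (k + 1) * J ≤ (k + 1) * (4 * k) := Nat.mul_le_mul_left _ hJ
  have hk4 : 1 * (4 * k) ≤ (k + 1) * (4 * k) := Nat.mul_le_mul_right _ (by omega)
  obtain ⟨c0, c1, c5, c6, c7, c8, c9, c23⟩ := hc
  have hp : a + J - 2 * k < n := by omega
  have l1 := hmem.list _ hp
  have l2 := hmem.lt _ hp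
  have hpow : 2 ^ (2 * k - a) ≤ 16 ^ k := by
    calc 2 ^ (2 * k - a) ≤ 2 ^ (4 * k) := Nat.pow_le_pow_right (by norm_num) (by omega)
      _ = 16 ^ k := by rw [pow_mul]; norm_num
  have hmod : (e - 1) - (e - 1) / (k + 1) * (k + 1) = (e - 1) % (k + 1) := by
    have := Nat.div_add_mod' (e - 1) (k + 1)
    omega
  have hmul : (e - 1) / (k + 1) * (k + 1) ≤ e - 1 := Nat.div_mul_le_self _ _
  have hlt : (e - 1) % (k + 1) < k + 1 := Nat.mod_lt _ (by omega)
  have hdiv : (e - 1) / (k + 1) ≤ e - 1 := Nat.div_le_self _ _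
  refine Within.assign_seq ?_ (by simp) ?_
  · simp [c5, h10, h12, c23, l1]
    omega
  refine Within.assign_seq ?_ (by simp) ?_
  · simp [h15, h25]
    omega
  refine Within.assign_seq (by simp) (by simp) ?_
  refine Within.assign_seq (by simp) (by simp) ?_
  have hs := within_scan (w := w) (a := a) (m := m) (P := σ (a + J - 2 * k)) hw
    (s₀ := (((s.setReg 16 ((Expr.load (.reg 5 + (.reg 10 + .reg 12 - .reg 23))).eval s)).setReg 19
      ((Expr.reg 15 / Expr.reg 25).eval (s.setReg 16
        ((Expr.load (.reg 5 + (.reg 10 + .reg 12 - .reg 23))).eval s)))).setReg 20 0).setReg 21 0)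
    hmem l2 ha.le hm (by simp [c0]) (by simp [c5]) (by simp [h10])
    (by simp [c5, h10, h12, c23, l1]) (by simp [h15, h25]) (by simp) (by simp)
    (by simp [c23])
  refine Within.seq ((hs.frame_mem ?_).mono le_rfl ?_) (by simp)
  · simp [scan, scanBody, Program.forLoop, Program.Storeless]
  rintro s' ⟨⟨j20, j21⟩, hf, jm⟩
  have jm : s'.mem = s.mem := jm
  have f0 : s'.reg 0 = n := by rw [hf 0 (by decide)]; simp [c0]
  have f1 : s'.reg 1 = k := by rw [hf 1 (by decide)]; simp [c1]
  have f6 : s'.reg 6 = 16 ^ k := by rw [hf 6 (by decide)]; simp [c6]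
  have f9 : s'.reg 9 = n * n + 2 * n := by rw [hf 9 (by decide)]; simp [c9]
  have f10 : s'.reg 10 = a := by rw [hf 10 (by decide)]; simp [h10]
  have f11 : s'.reg 11 = m' := by rw [hf 11 (by decide)]; simp [h11]
  have f12 : s'.reg 12 = J := by rw [hf 12 (by decide)]; simp [h12]
  have f17 : s'.reg 17 = e := by rw [hf 17 (by decide)]; simp [h17]
  have hnot := notMem_prefixSet (n := n) hbit lo
  have hins := cut_insert (b := fun p q => A (σ p) (σ q)) hnot hp (hA _ l2)
  rw [← prefixSet_succ hbit heq lo hi] at hins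
  set c := cut n (fun p q => A (σ p) (σ q)) (prefixSet n k (a + 1) m') with hcdef
  rw [← j20, ← j21, ← hcut] at hins
  have hout : s'.reg 20 ≤ n := by
    rw [j20]
    refine (sum_le_card_nsmul _ _ 1 fun q _ => hmem.le_one _ _).trans ?_
    have := card_le_card (sdiff_subset (s := range n) (t := prefixSet n k a m))
    simpa using this
  have hin : s'.reg 21 ≤ n := by
    rw [j21]
    refine (sum_le_card_nsmul _ _ 1 fun q _ => hmem.le_one _ _).trans ?_
    have := card_le_card (filter_subset (fun p => p + 2 * k < a ∨ m.testBit (p + 2 * k - a) = true)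
      (range n))
    simpa [prefixSet] using this
  refine Within.assign_seq ?_ (by simp) ?_
  · simp [f17, f1]
    rw [hmod]
    omega
  have hval : (Expr.reg 17 - 1 - (Expr.reg 17 - 1) / (Expr.reg 1 + 1) * (Expr.reg 1 + 1) +
      Expr.reg 20 - Expr.reg 21).eval s' = c := by
    simp [f17, f1]
    rw [hmod]
    omega
  rw [hval]
  refine Within.ite ?_ (by simp) (fun h => ?_) (fun h => ?_)
  · simp [f1]
    omega
  · simp [f1] at h
    refine Within.store ?_ ?_ ?_ (by simp)
    · simp [f9, f10, f6, f11]
      omega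
    · simp [f1, f12]
      omega
    · left
      refine ⟨by omega, ?_⟩
      simp [State.setMem, f9, f10, f6, f11, f1, f12, jm]
  · simp [f1] at h
    refine Within.skip ?_ (by simp)
    right
    exact ⟨by omega, jm⟩

end CutDP

/-! ### The loops over bits and masks -/

namespace CutDP

open Finset WordRAM

/-- Try to obtain the mask in register `11` by adding the bit with the number in register `12`. -/
def bitBody : Program :=
  15 ::= .reg 11 + .reg 11 + 1 - .reg 14 ;;
  -- A product acts as a conjunction: the current bit of `2 * m' + 1` is set, the previous mask is
  -- below `16 ^ k`, and the added number lies between `0` and `n - 1`. Each truncated difference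
  -- vanishes exactly when its condition fails.
  .ite ((.reg 13 - .reg 13 / 2 * 2) * ((.reg 6 - .reg 15) *
      ((.reg 10 + .reg 12 + 1 - .reg 23) * (.reg 0 + .reg 23 - (.reg 10 + .reg 12)))))
    (17 ::= .load (.reg 9 + (.reg 10 * .reg 6 + .reg 15)) ;; .ite (.reg 17) tryEdge .skip)
    .skip ;;
  13 ::= .reg 13 / 2 ;;
  14 ::= .reg 14 + .reg 14

/-- Compute the table entry of the mask in register `11`. -/
def maskBody : Program :=
  13 ::= .reg 11 + .reg 11 + 1 ;;
  14 ::= 1 ;;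
  .forLoop 12 8 bitBody

/-- Compute the table entries of a level. -/
def levelBody : Program :=
  .forLoop 11 6 maskBody ;;
  -- Halving that stops at `1`, in accordance with the truncated exponent in `2 ^ (2 * k - a)`.
  25 ::= .reg 25 / 2 + (1 - .reg 25 / 2)

/-- Compute the table. -/
def table : Program := .forLoop 10 0 levelBody

theorem Cell.succ_of_not_edge {n k a m' J v : ℕ} {b : ℕ → ℕ → ℕ} (h : Cell n k b a m' J v)
    (hJ : ∀ m, Reach n k b a m → ¬ Edge n k b a m J m') : Cell n k b a m' (J + 1) v := by
  rcases h with ⟨rfl, h⟩ | ⟨m, j, hj, h⟩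
  · refine .inl ⟨rfl, fun m j hj hr => ?_⟩
    rcases Nat.lt_succ_iff_lt_or_eq.1 hj with h1 | rfl
    · exact h m j h1 hr
    · exact hJ m hr
  · exact .inr ⟨m, j, by omega, h⟩

/-- Trying the bit with number `J` completes the table entry with respect to this bit. -/
theorem within_bitTry {n k w a m' J e : ℕ} {A : ℕ → ℕ → ℕ} {σ : ℕ → ℕ} {s : State}
    (hw : Fit n k w) (hmem : Sorted n A σ s.mem) (hA : ∀ v < n, A v v = 0) (hc : Consts n k s)
    (ha : a < n) (hm' : m' < 16 ^ k)
    (h10 : s.reg 10 = a) (h11 : s.reg 11 = m') (h12 : s.reg 12 = J)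
    (h13 : s.reg 13 = (2 * m' + 1) / 2 ^ J) (h15 : s.reg 15 = 2 * m' + 1 - 2 ^ J)
    (h25 : s.reg 25 = 2 ^ (2 * k - a)) (hJ : J ≤ 4 * k)
    (hentry : ∀ m < 16 ^ k, Entry n k (fun p q => A (σ p) (σ q)) a m
      (s.mem (n * n + 2 * n + (a * 16 ^ k + m))))
    (hcell : s.mem (n * n + 2 * n + ((a + 1) * 16 ^ k + m')) = e)
    (he : Cell n k (fun p q => A (σ p) (σ q)) a m' J e) :
    Within w (.ite ((.reg 13 - .reg 13 / 2 * 2) * ((.reg 6 - .reg 15) *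
      ((.reg 10 + .reg 12 + 1 - .reg 23) * (.reg 0 + .reg 23 - (.reg 10 + .reg 12)))))
      (17 ::= .load (.reg 9 + (.reg 10 * .reg 6 + .reg 15)) ;; .ite (.reg 17) tryEdge .skip)
      .skip) s (n * 100 + 170) fun s' =>
      ∃ v, Cell n k (fun p q => A (σ p) (σ q)) a m' (J + 1) v ∧
        s'.mem = Function.update s.mem (n * n + 2 * n + ((a + 1) * 16 ^ k + m')) v := by
  have hw1 := hw.table
  have hw2 := hw.entry
  have hw3 := hw.mul
  have hw0 := hw.ne_zero
  have hM1 : (a + 1) * 16 ^ k ≤ n * 16 ^ k := Nat.mul_le_mul_right _ ha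
  have hM2 : (n + 3) * 16 ^ k = n * 16 ^ k + 3 * 16 ^ k := by ring
  have hM3 : (a + 1) * 16 ^ k = a * 16 ^ k + 16 ^ k := by ring
  have hk1 : (k + 1) * (4 * k + 2) = (k + 1) * (4 * k + 1) + (k + 1) := by ring
  have hk2 : (k + 1) * (4 * k + 1) = (k + 1) * (4 * k) + (k + 1) := by ring
  have hk4 : 1 * (4 * k) ≤ (k + 1) * (4 * k) := Nat.mul_le_mul_right _ (by omega)
  obtain ⟨c0, c1, c5, c6, c7, c8, c9, c23⟩ := hc
  have hd := Nat.div_le_self (2 * m' + 1) (2 ^ J)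
  have hpos : 0 < 2 ^ J := by positivity
  have hnoop : (∀ m, Reach n k (fun p q => A (σ p) (σ q)) a m →
      ¬ Edge n k (fun p q => A (σ p) (σ q)) a m J m') → ∃ v,
      Cell n k (fun p q => A (σ p) (σ q)) a m' (J + 1) v ∧
        s.mem = Function.update s.mem (n * n + 2 * n + ((a + 1) * 16 ^ k + m')) v := by
    intro h
    exact ⟨e, he.succ_of_not_edge h, by rw [← hcell, Function.update_eq_self]⟩
  have hguard : (Expr.eval s ((.reg 13 - .reg 13 / 2 * 2) * ((.reg 6 - .reg 15) *
      ((.reg 10 + .reg 12 + 1 - .reg 23) * (.reg 0 + .reg 23 - (.reg 10 + .reg 12)))))) =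
      ((2 * m' + 1) / 2 ^ J % 2) * ((16 ^ k - (2 * m' + 1 - 2 ^ J)) *
        ((a + J + 1 - 2 * k) * (n + 2 * k - (a + J)))) := by
    simp only [Expr.eval_hMul, Expr.eval_hSub, Expr.eval_hAdd, Expr.eval_hDiv, Expr.eval_reg,
      Expr.eval_ofNat, c0, c6, c23, h10, h12, h13, h15]
    congr 1
    omega
  -- The new mask and the bit determine the previous mask, so one lookup per bit suffices.
  have hedge : ∀ m, Reach n k (fun p q => A (σ p) (σ q)) a m →
      Edge n k (fun p q => A (σ p) (σ q)) a m J m' → m = 2 * m' + 1 - 2 ^ J ∧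
      (2 * m' + 1).testBit J = true := by
    intro m _ h2
    have := h2.eq
    refine ⟨by omega, ?_⟩
    rw [h2.eq, testBit_add_two_pow h2.bit]
    simp
  refine Within.ite ?_ (by simp) (fun h => ?_) (fun h => ?_)
  · have q1 : (a + J + 1 - 2 * k) * (n + 2 * k - (a + J)) ≤
        (n + 4 * k + 17) * (n + 4 * k + 17) := Nat.mul_le_mul (by omega) (by omega)
    have q2 : (16 ^ k - (2 * m' + 1 - 2 ^ J)) * ((a + J + 1 - 2 * k) * (n + 2 * k - (a + J))) ≤
        16 ^ k * ((n + 4 * k + 17) * (n + 4 * k + 17)) :=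
      Nat.mul_le_mul (Nat.sub_le _ _) q1
    have q3 : ((2 * m' + 1) / 2 ^ J % 2) * ((16 ^ k - (2 * m' + 1 - 2 ^ J)) *
        ((a + J + 1 - 2 * k) * (n + 2 * k - (a + J)))) ≤
        1 * (16 ^ k * ((n + 4 * k + 17) * (n + 4 * k + 17))) :=
      Nat.mul_le_mul (by omega) q2
    have q4 : 1 * ((n + 4 * k + 17) * (n + 4 * k + 17)) ≤
        16 ^ k * ((n + 4 * k + 17) * (n + 4 * k + 17)) :=
      Nat.mul_le_mul_right _ (Nat.one_le_pow _ _ (by norm_num))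
    rw [Expr.fits_hMul]
    refine ⟨?_, ?_, ?_⟩
    · simp only [Expr.fits_hSub, Expr.fits_hMul, Expr.fits_hDiv, Expr.fits_reg, Expr.fits_ofNat,
        Expr.eval_hDiv, Expr.eval_reg, Expr.eval_ofNat, h13]
      omega
    · simp only [Expr.fits_hSub, Expr.fits_hMul, Expr.fits_hAdd, Expr.fits_reg, Expr.fits_ofNat,
        Expr.eval_hSub, Expr.eval_hMul, Expr.eval_hAdd, Expr.eval_reg, Expr.eval_ofNat,
        c0, c6, c23, h10, h12, h15]
      omega
    · rw [← Expr.eval_hMul, hguard]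
      omega
  · rw [hguard] at h
    have g1 : (2 * m' + 1) / 2 ^ J % 2 ≠ 0 := left_ne_zero_of_mul h
    have g2 := right_ne_zero_of_mul h
    have g3 : 16 ^ k - (2 * m' + 1 - 2 ^ J) ≠ 0 := left_ne_zero_of_mul g2
    have g4 := right_ne_zero_of_mul g2
    have g5 : a + J + 1 - 2 * k ≠ 0 := left_ne_zero_of_mul g4
    have g6 : n + 2 * k - (a + J) ≠ 0 := right_ne_zero_of_mul g4
    have hbit : (2 * m' + 1).testBit J = true := by
      rw [Nat.testBit_eq_decide_div_mod_eq, decide_eq_true_eq]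
      omega
    obtain ⟨hb1, hb2⟩ := testBit_sub_two_pow hbit
    have hent := hentry (2 * m' + 1 - 2 ^ J) (by omega)
    have hle := hent.le
    have hev : (Expr.load (.reg 9 + (.reg 10 * .reg 6 + .reg 15))).eval s =
        s.mem (n * n + 2 * n + (a * 16 ^ k + (2 * m' + 1 - 2 ^ J))) := by
      simp only [Expr.eval_load, Expr.eval_hAdd, Expr.eval_hMul, Expr.eval_reg, c9, h10, c6, h15]
    generalize hu : s.mem (n * n + 2 * n + (a * 16 ^ k + (2 * m' + 1 - 2 ^ J))) = u
      at hent hle hev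
    refine Within.assign_seq ?_ (by simp) ?_
    · rw [Expr.fits_load, ← Expr.eval_load, hev]
      simp only [Expr.fits_hAdd, Expr.fits_hMul, Expr.fits_reg, Expr.eval_hAdd, Expr.eval_hMul,
        Expr.eval_reg, c9, h10, c6, h15]
      omega
    rw [hev]
    refine Within.ite ?_ (by simp) (fun h => ?_) (fun h => ?_)
    · simp only [Expr.fits_reg, State.reg_setReg, if_true]
      omega
    · have hu0 : u ≠ 0 := by simpa using h
      have hreach := hent.ne_zero_iff.1 hu0
      refine (within_tryEdge (s := s.setReg 17 u) (e := u) (m := 2 * m' + 1 - 2 ^ J) hw hmem hA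
        ⟨by simp [c0], by simp [c1], by simp [c5], by simp [c6], by simp [c7], by simp [c8],
          by simp [c9], by simp [c23]⟩ ha (by omega) hm' (by simp [h10]) (by simp [h11])
        (by simp [h12]) (by simp [h15]) (by simp) (by simp [h25]) hJ (by omega) (by omega)
        hb1 hb2 hle (hent.cut_eq hu0).1).mono (by simp) ?_
      rintro s' (⟨hs1, hs2⟩ | ⟨hs1, hs2⟩)
      · exact ⟨_, .inr ⟨_, J, by omega, hreach, ⟨hb1, hb2, hJ, by omega, by omega, hs1⟩, rfl⟩,
          hs2⟩
      · rw [hs2]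
        refine hnoop fun m hm hE => ?_
        have := hE.cut_le
        omega
    · have hu0 : u = 0 := by simpa using h
      refine Within.skip (hnoop fun m hm hE => ?_) (by simp)
      rw [(hedge m hm hE).1] at hm
      exact hent.ne_zero_iff.2 hm hu0
  · rw [hguard] at h
    refine Within.skip (hnoop fun m hm hE => ?_) (by simp)
    obtain ⟨h1, h2⟩ := hedge m hm hE
    have h3 := hm.lt
    have h4 := hE.lo
    have h5 := hE.hi
    rw [Nat.testBit_eq_decide_div_mod_eq, decide_eq_true_eq] at h2
    refine absurd h ?_
    rw [h2]
    refine mul_ne_zero (by omega) (mul_ne_zero (by omega) (mul_ne_zero (by omega) (by omega)))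

theorem two_pow_le_sixteen_pow {k J : ℕ} (h : J ≤ 4 * k) : 2 ^ J ≤ 16 ^ k := by
  calc 2 ^ J ≤ 2 ^ (4 * k) := Nat.pow_le_pow_right (by norm_num) h
    _ = 16 ^ k := by rw [pow_mul]; norm_num

theorem within_maskBody {n k w a m' : ℕ} {A : ℕ → ℕ → ℕ} {σ : ℕ → ℕ} {s : State}
    (hw : Fit n k w) (hmem : Sorted n A σ s.mem) (hA : ∀ v < n, A v v = 0) (hc : Consts n k s)
    (ha : a < n) (hm' : m' < 16 ^ k)
    (h10 : s.reg 10 = a) (h11 : s.reg 11 = m') (h25 : s.reg 25 = 2 ^ (2 * k - a))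
    (hT : Table n k (fun p q => A (σ p) (σ q)) ((a + 1) * 16 ^ k + m') s.mem) :
    Within w maskBody s ((4 * k + 1) * (n * 100 + 208) + 20) fun s' =>
      Sorted n A σ s'.mem ∧
      Table n k (fun p q => A (σ p) (σ q)) ((a + 1) * 16 ^ k + (m' + 1)) s'.mem := by
  have hw1 := hw.table
  have hw2 := hw.entry
  have hw0 := hw.ne_zero
  have hM1 : (a + 1) * 16 ^ k ≤ n * 16 ^ k := Nat.mul_le_mul_right _ ha
  have hM2 : (n + 3) * 16 ^ k = n * 16 ^ k + 3 * 16 ^ k := by ring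
  have hM3 : (a + 1) * 16 ^ k = a * 16 ^ k + 16 ^ k := by ring
  have hk4 : 1 * (4 * k + 2) ≤ (k + 1) * (4 * k + 2) := Nat.mul_le_mul_right _ (by omega)
  have hMpos : 0 < 16 ^ k := by positivity
  have hdm : ((a + 1) * 16 ^ k + m') / 16 ^ k = a + 1 ∧ ((a + 1) * 16 ^ k + m') % 16 ^ k = m' := by
    rw [add_comm, Nat.add_mul_div_right _ _ hMpos, Nat.add_mul_mod_self_right,
      Nat.div_eq_of_lt hm', Nat.mod_eq_of_lt hm']
    simp
  obtain ⟨c0, c1, c5, c6, c7, c8, c9, c23⟩ := hc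
  refine Within.assign_seq ?_ (by simp) (Within.assign_seq (by simp; omega) (by simp) ?_)
  · simp [h11]
    omega
  have hloop : Within w (.forLoop 12 8 bitBody)
      ((s.setReg 13 ((Expr.reg 11 + Expr.reg 11 + 1).eval s)).setReg 14 1)
      ((4 * k + 1) * (n * 100 + 200 + 8) + 6) fun s' =>
      s'.reg 13 = (2 * m' + 1) / 2 ^ (4 * k + 1) ∧ s'.reg 14 = 2 ^ (4 * k + 1) ∧
      ∃ v, Cell n k (fun p q => A (σ p) (σ q)) a m' (4 * k + 1) v ∧
        s'.mem = Function.update s.mem (n * n + 2 * n + ((a + 1) * 16 ^ k + m')) v := by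
    refine Within.forLoop_frame (fun J s' =>
      s'.reg 13 = (2 * m' + 1) / 2 ^ J ∧ s'.reg 14 = 2 ^ J ∧
      ∃ v, Cell n k (fun p q => A (σ p) (σ q)) a m' J v ∧
        s'.mem = Function.update s.mem (n * n + 2 * n + ((a + 1) * 16 ^ k + m')) v)
      (by omega) (by decide) (by decide) (by decide) (by simp [c8]) ?_ ?_
    -- The still untouched entry is `0`, the correct cell before any bit has been tried.
    · refine ⟨by simp [h11]; omega, by simp, 0, .inl ⟨rfl, by omega⟩, ?_⟩
      rw [State.mem_setReg, State.mem_setReg, State.mem_setReg, ← hT.zero _ le_rfl,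
        Function.update_eq_self]
    · rintro J hJ s' ⟨i13, i14, v, hv, hmv⟩ i12 hf -
      have f0 : s'.reg 0 = n := by rw [hf 0 (by decide)]; simp [c0]
      have f1 : s'.reg 1 = k := by rw [hf 1 (by decide)]; simp [c1]
      have f5 : s'.reg 5 = n * n := by rw [hf 5 (by decide)]; simp [c5]
      have f6 : s'.reg 6 = 16 ^ k := by rw [hf 6 (by decide)]; simp [c6]
      have f7 : s'.reg 7 = 4 ^ k - 1 := by rw [hf 7 (by decide)]; simp [c7]
      have f8 : s'.reg 8 = 4 * k + 1 := by rw [hf 8 (by decide)]; simp [c8]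
      have f9 : s'.reg 9 = n * n + 2 * n := by rw [hf 9 (by decide)]; simp [c9]
      have f10 : s'.reg 10 = a := by rw [hf 10 (by decide)]; simp [h10]
      have f11 : s'.reg 11 = m' := by rw [hf 11 (by decide)]; simp [h11]
      have f23 : s'.reg 23 = 2 * k := by rw [hf 23 (by decide)]; simp [c23]
      have f25 : s'.reg 25 = 2 ^ (2 * k - a) := by rw [hf 25 (by decide)]; simp [h25]
      have hpow := two_pow_le_sixteen_pow (k := k) (J := J) (by omega)
      have hd := Nat.div_le_self (2 * m' + 1) (2 ^ J)
      have hev : (Expr.reg 11 + Expr.reg 11 + 1 - Expr.reg 14).eval s' = 2 * m' + 1 - 2 ^ J := by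
        simp [f11, i14]; omega
      refine Within.assign_seq ?_ (by simp) ?_
      · simp [f11, i14]
        omega
      rw [hev]
      have hS : Sorted n A σ s'.mem := by rw [hmv]; exact hmem.update _ _
      have htry := within_bitTry (w := w) (a := a) (m' := m') (J := J) (e := v)
        (s := s'.setReg 15 (2 * m' + 1 - 2 ^ J)) hw hS hA
        ⟨by simp [f0], by simp [f1], by simp [f5], by simp [f6], by simp [f7], by simp [f8],
          by simp [f9], by simp [f23]⟩ ha hm' (by simp [f10]) (by simp [f11]) (by simp [i12])
        (by simp [i13]) (by simp) (by simp [f25]) (by omega) (by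
          -- Level `a` is already complete, and it is disjoint from the cell of level `a + 1` being
          -- written.
          intro m hm
          have := hT.entry (a * 16 ^ k + m) (by omega)
          rw [add_comm (a * 16 ^ k) m, Nat.add_mul_div_right _ _ hMpos,
            Nat.add_mul_mod_self_right, Nat.div_eq_of_lt hm, Nat.mod_eq_of_lt hm, zero_add] at this
          rw [State.mem_setReg, hmv, Function.update_of_ne (by omega), add_comm (a * 16 ^ k) m]
          exact this) (by rw [State.mem_setReg, hmv, Function.update_self]) hv
      refine Within.seq (htry.frame.mono le_rfl ?_) (by simp)
      rintro s'' ⟨⟨v', hv', hm''⟩, hf'⟩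
      have g13 : s''.reg 13 = (2 * m' + 1) / 2 ^ J := by rw [hf' 13 (by decide)]; simp [i13]
      have g14 : s''.reg 14 = 2 ^ J := by rw [hf' 14 (by decide)]; simp [i14]
      refine Within.assign_seq ?_ (by simp) (Within.assign ?_ ?_ (by simp))
      · simp [g13]
        omega
      · simp [g14]
        omega
      · refine ⟨?_, ?_, v', hv', ?_⟩
        · simp [g13, pow_succ, Nat.div_div_eq_div_mul]
        · simp [g14, pow_succ, mul_two]
        · simp [hm'', hmv]
  refine hloop.mono (by simp) ?_
  · rintro s' ⟨-, -, v, hv, hm⟩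
    rw [hm]
    refine ⟨hmem.update _ _, ?_⟩
    rw [← add_assoc]
    refine hT.update ?_
    rw [hdm.1, hdm.2]
    exact hv

end CutDP

/-! ### The loop over the levels -/

namespace CutDP

open Finset WordRAM

theorem Table.entry_at {n k X a m : ℕ} {b : ℕ → ℕ → ℕ} {mem : ℕ → ℕ} (h : Table n k b X mem)
    (hm : m < 16 ^ k) (hX : a * 16 ^ k + m < X) :
    Entry n k b a m (mem (n * n + 2 * n + (a * 16 ^ k + m))) := by
  have := h.entry _ hX
  rwa [add_comm (a * 16 ^ k) m, Nat.add_mul_div_right _ _ (by positivity),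
    Nat.add_mul_mod_self_right, Nat.div_eq_of_lt hm, Nat.mod_eq_of_lt hm, zero_add,
    add_comm m] at this

/-- The number of steps in which a level of the table is computed. -/
def levelTime (n k : ℕ) : ℕ := 16 ^ k * ((4 * k + 1) * (n * 100 + 208) + 20 + 8) + 20

theorem within_levelBody {n k w a : ℕ} {A : ℕ → ℕ → ℕ} {σ : ℕ → ℕ} {s : State}
    (hw : Fit n k w) (hmem : Sorted n A σ s.mem) (hA : ∀ v < n, A v v = 0) (hc : Consts n k s)
    (ha : a < n) (h10 : s.reg 10 = a) (h25 : s.reg 25 = 2 ^ (2 * k - a))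
    (hT : Table n k (fun p q => A (σ p) (σ q)) ((a + 1) * 16 ^ k) s.mem) :
    Within w levelBody s (levelTime n k) fun s' =>
      s'.reg 25 = 2 ^ (2 * k - (a + 1)) ∧ Sorted n A σ s'.mem ∧
      Table n k (fun p q => A (σ p) (σ q)) ((a + 1 + 1) * 16 ^ k) s'.mem := by
  have hw1 := hw.table
  have hw0 := hw.ne_zero
  have hM2 : (n + 3) * 16 ^ k = n * 16 ^ k + 3 * 16 ^ k := by ring
  have hpow := two_pow_le_sixteen_pow (k := k) (J := 2 * k - a) (by omega)
  have hloop : Within w (.forLoop 11 6 maskBody) s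
      (16 ^ k * ((4 * k + 1) * (n * 100 + 208) + 20 + 8) + 6) fun s' =>
      Sorted n A σ s'.mem ∧
      Table n k (fun p q => A (σ p) (σ q)) ((a + 1) * 16 ^ k + 16 ^ k) s'.mem := by
    refine Within.forLoop_frame (fun m' s' => Sorted n A σ s'.mem ∧
      Table n k (fun p q => A (σ p) (σ q)) ((a + 1) * 16 ^ k + m') s'.mem)
      (by omega) (by decide) (by decide) (by decide) hc.r6 ⟨hmem, hT⟩ ?_
    rintro m' hm' s' ⟨hS, hT'⟩ i11 hf -
    exact within_maskBody hw hS hA (hc.congr hf (by decide)) ha hm'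
      ((hf 10 (by decide)).trans h10) i11 ((hf 25 (by decide)).trans h25) hT'
  refine Within.seq (hloop.frame.mono le_rfl ?_) ?_
  · rintro s' ⟨⟨hS, hT'⟩, hf⟩
    have f25 := (hf 25 (by decide)).trans h25
    refine Within.assign ?_ ⟨?_, hS, ?_⟩ ?_
    · simp [f25]
      omega
    · simp [f25]
      rcases lt_or_ge a (2 * k) with h | h
      · have e : 2 * k - a = 2 * k - (a + 1) + 1 := by omega
        rw [e, pow_succ]
        have : 0 < 2 ^ (2 * k - (a + 1)) := by positivity
        omega
      · have e : 2 * k - a = 0 := by omega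
        have e' : 2 * k - (a + 1) = 0 := by omega
        rw [e, e']
        norm_num
    · rw [add_mul (a + 1), one_mul]
      exact hT'
    · simp [levelTime]
  · unfold levelTime
    omega

theorem within_table {n k w : ℕ} {A : ℕ → ℕ → ℕ} {σ : ℕ → ℕ} {s : State}
    (hw : Fit n k w) (hmem : Sorted n A σ s.mem) (hA : ∀ v < n, A v v = 0) (hc : Consts n k s)
    (h25 : s.reg 25 = 4 ^ k)
    (hT : Table n k (fun p q => A (σ p) (σ q)) (16 ^ k) s.mem) :
    Within w table s (n * (levelTime n k + 8) + 6) fun s' =>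
      Sorted n A σ s'.mem ∧
      Table n k (fun p q => A (σ p) (σ q)) ((n + 1) * 16 ^ k) s'.mem := by
  have hw1 := hw.entry
  refine (Within.forLoop_frame (fun a s' => s'.reg 25 = 2 ^ (2 * k - a) ∧
    Sorted n A σ s'.mem ∧ Table n k (fun p q => A (σ p) (σ q)) ((a + 1) * 16 ^ k) s'.mem)
    (by omega) (by decide) (by decide) (by decide) hc.r0
    ⟨?_, hmem, by simpa using hT⟩ ?_).mono le_rfl fun s' h => h.2
  · simp [h25, pow_mul]
  · rintro a ha s' ⟨i25, hS, hT'⟩ i10 hf -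
    refine (within_levelBody hw hS hA (hc.congr hf (by decide)) ha i10 i25 hT').mono le_rfl ?_
    rintro s'' ⟨h1, h2, h3⟩
    exact ⟨by simpa using h1, h2, h3⟩

/-! ### Initialization and sorting -/

/-- Compute the constants. -/
def initConsts : Program :=
  5 ::= .reg 0 * .reg 0 ;;
  9 ::= .reg 5 + .reg 0 + .reg 0 ;;
  23 ::= .reg 1 + .reg 1 ;;
  8 ::= .reg 23 + .reg 23 + 1 ;;
  6 ::= 1 ;;
  7 ::= 0 ;;
  25 ::= 1 ;;
  .forLoop 2 1 (6 ::= 16 * .reg 6 ;; 7 ::= 4 * .reg 7 + 3 ;; 25 ::= 4 * .reg 25)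

theorem within_initConsts {n k w : ℕ} {s : State} (hw : Fit n k w) (h0 : s.reg 0 = n)
    (h1 : s.reg 1 = k) :
    Within w initConsts s (k * 50 + 60) fun s' =>
      Consts n k s' ∧ s'.reg 25 = 4 ^ k ∧ s'.mem = s.mem := by
  have hw1 := hw.table
  have hw2 := hw.entry
  have hw0 := hw.ne_zero
  have hM2 : (n + 3) * 16 ^ k = n * 16 ^ k + 3 * 16 ^ k := by ring
  have hk4 : 1 * (4 * k + 2) ≤ (k + 1) * (4 * k + 2) := Nat.mul_le_mul_right _ (by omega)
  refine Within.assign_seq ?_ (by simp) ?_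
  · simp [h0]; omega
  refine Within.assign_seq ?_ (by simp) ?_
  · simp [h0]; omega
  refine Within.assign_seq ?_ (by simp) ?_
  · simp [h1]; omega
  refine Within.assign_seq ?_ (by simp) ?_
  · simp [h1]; omega
  refine Within.assign_seq (by simp; omega) (by simp) ?_
  refine Within.assign_seq (by simp) (by simp) ?_
  refine Within.assign_seq (by simp; omega) (by simp) ?_
  have hloop := Within.forLoop_frame (w := w) (x := 2) (b := 1) (N := k) (T := 40)
    (p := 6 ::= 16 * .reg 6 ;; 7 ::= 4 * .reg 7 + 3 ;; 25 ::= 4 * .reg 25)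
    (s₀ := ((((((s.setReg 5 (n * n)).setReg 9 (n * n + n + n)).setReg 23 (k + k)).setReg 8
      (k + k + (k + k) + 1)).setReg 6 1).setReg 7 0).setReg 25 1)
    (fun i s' => s'.reg 6 = 16 ^ i ∧ s'.reg 7 = 4 ^ i - 1 ∧ s'.reg 25 = 4 ^ i)
    (by omega) (by decide) (by decide) (by decide) (by simp [h1]) (by simp) (by
      rintro i hi s' ⟨i6, i7, i25⟩ - hf -
      have p1 : 16 ^ (i + 1) ≤ 16 ^ k := Nat.pow_le_pow_right (by norm_num) hi
      have p2 := four_pow_le i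
      have p3 : 0 < 4 ^ i := by positivity
      rw [pow_succ] at p1
      have := hw1
      refine Within.assign_seq ?_ (by simp) (Within.assign_seq ?_ (by simp)
        (Within.assign ?_ ?_ (by simp)))
      · simp [i6]; omega
      · simp [i7]; omega
      · simp [i25]; omega
      · simp [i6, i7, i25, pow_succ]
        omega)
  -- The start state of the goal contains unevaluated expressions; this exchanges it for the one
  -- with explicit values.
  have hs : ∀ s₁ s₂ : State, s₁ = s₂ → ∀ {p T Q}, Within w p s₁ T Q → Within w p s₂ T Q := by
    rintro s₁ s₂ rfl p T Q h; exact h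
  refine hs _ _ ?_ ((hloop.frame_mem (by simp [Program.forLoop, Program.Storeless])).mono
    (by simp; omega) ?_)
  · simp [h0, h1]
  · rintro s' ⟨⟨i6, i7, i25⟩, hf, hm⟩
    refine ⟨⟨?_, ?_, ?_, i6, i7, ?_, ?_, ?_⟩, i25, hm⟩
    · rw [hf 0 (by decide)]; simp [h0]
    · rw [hf 1 (by decide)]; simp [h1]
    · rw [hf 5 (by decide)]; simp
    · rw [hf 8 (by decide)]; simp; omega
    · rw [hf 9 (by decide)]; simp; omega
    · rw [hf 23 (by decide)]; simp; omega

/-- Compute the sorting key of the vertex in register `2`. -/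
def keyBody : Program :=
  4 ::= 0 ;;
  .forLoop 3 0 (4 ::= .reg 4 + .load (.reg 2 * .reg 0 + .reg 3)) ;;
  .store (.reg 5 + .reg 0 + .reg 2) (.reg 4 * .reg 0 + .reg 2)

/-- Put the vertex in register `2` at its position in the sorted list. -/
def rankBody : Program :=
  4 ::= 0 ;;
  -- Counting the smaller keys for every vertex takes quadratic time, which the budget allows.
  .forLoop 3 0 (4 ::= .reg 4 +
    (1 - (1 - (.load (.reg 5 + .reg 0 + .reg 2) - .load (.reg 5 + .reg 0 + .reg 3))))) ;;
  .store (.reg 5 + .reg 4) (.reg 2)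

/-- Sort the vertices by out-degree. -/
def sortVertices : Program := .forLoop 2 0 keyBody ;; .forLoop 2 0 rankBody

section

variable {n k w : ℕ} {A : ℕ → ℕ → ℕ} {I : ℕ → ℕ} {s : State}

theorem key_le (hA : ∀ u v, A u v ≤ 1) {v : ℕ} (hv : v < n) :
    outdeg n A v ≤ n ∧ key n A v ≤ n * n + n := by
  have h : outdeg n A v ≤ n := by
    refine (sum_le_card_nsmul _ _ 1 fun q _ => hA v q).trans ?_
    simp
  refine ⟨h, ?_⟩
  have := Nat.mul_le_mul_right n h
  unfold key
  omega

/-- Memory layout: the matrix below `n * n`, then `n` cells for the sorted list, `n` cells for the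
keys, and the table from `n * n + 2 * n` on. -/
theorem within_keys (hw : Fit n k w) (hc : Consts n k s) (hA : ∀ u v, A u v ≤ 1)
    (hmat : ∀ u < n, ∀ v < n, s.mem (u * n + v) = A u v)
    (hzero : ∀ x, n * n ≤ x → s.mem x = 0) :
    Within w (.forLoop 2 0 keyBody) s (n * (n * 30 + 60) + 6) fun s' =>
      (∀ u < n, ∀ v < n, s'.mem (u * n + v) = A u v) ∧
      (∀ v < n, s'.mem (n * n + n + v) = key n A v) ∧
      ∀ x, n * n + 2 * n ≤ x → s'.mem x = 0 := by
  have hw1 := hw.table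
  have hw0 := hw.ne_zero
  have hrun : Within w (.forLoop 2 0 keyBody) s (n * (n * 30 + 52 + 8) + 6) fun s' =>
      (∀ u < n, ∀ v < n, s'.mem (u * n + v) = A u v) ∧
      (∀ v < n, s'.mem (n * n + n + v) = key n A v) ∧
      ∀ x, n * n + 2 * n ≤ x → s'.mem x = 0 := by
    refine Within.forLoop_frame (fun i s' => (∀ u < n, ∀ v < n, s'.mem (u * n + v) = A u v) ∧
      (∀ v < i, s'.mem (n * n + n + v) = key n A v) ∧
      ∀ x, n * n + 2 * n ≤ x → s'.mem x = 0)
      (by omega) (by decide) (by decide) (by decide) hc.r0 ⟨hmat, by simp, fun x hx =>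
        hzero x (by omega)⟩ ?_
    rintro i hi s' ⟨m1, m2, m3⟩ i2 hf -
    have hc' := hc.congr hf (by decide)
    refine Within.assign_seq (by simp) (by simp) ?_
    have hloop := Within.forLoop_frame (w := w) (x := 3) (b := 0) (N := n) (T := 22)
      (p := 4 ::= .reg 4 + .load (.reg 2 * .reg 0 + .reg 3)) (s₀ := s'.setReg 4 0)
      (fun j s' => s'.reg 4 = ∑ u ∈ range j, A i u)
      (by omega) (by decide) (by decide) (by decide) (by simp [hc'.r0]) (by simp) (by
        rintro j hj s₂ i4 i3 hf₂ hm₂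
        have f0 : s₂.reg 0 = n := by rw [hf₂ 0 (by decide)]; simp [hc'.r0]
        have f2 : s₂.reg 2 = i := by rw [hf₂ 2 (by decide)]; simp [i2]
        have hm : s₂.mem (i * n + j) = A i j := by rw [hm₂ trivial]; exact m1 i hi j hj
        have hlt := mul_add_lt hi hj
        have hA1 := hA i j
        have hs : ∑ u ∈ range j, A i u ≤ j := by
          refine (sum_le_card_nsmul _ _ 1 fun q _ => hA i q).trans ?_
          simp
        refine Within.assign ?_ ?_ (by simp)
        · simp [i4, i3, f0, f2, hm]
          omega
        · simp [i4, i3, f0, f2, hm, sum_range_succ])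
    refine Within.seq ((hloop.frame_mem ⟨trivial, trivial, trivial⟩).mono le_rfl ?_)
      (by simp)
    rintro s₂ ⟨i4, hf₂, hm₂⟩
    rw [State.mem_setReg] at hm₂
    have f0 : s₂.reg 0 = n := by rw [hf₂ 0 (by decide)]; simp [hc'.r0]
    have f2 : s₂.reg 2 = i := by rw [hf₂ 2 (by decide)]; simp [i2]
    have f5 : s₂.reg 5 = n * n := by rw [hf₂ 5 (by decide)]; simp [hc'.r5]
    obtain ⟨hd, hk⟩ := key_le hA hi
    have i4 : s₂.reg 4 = outdeg n A i := i4
    have hmul := Nat.mul_le_mul_right n hd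
    refine Within.store ?_ ?_ ?_ (by simp)
    · simp [f5, f0, f2]
      omega
    · simp [i4, f0, f2]
      omega
    · refine ⟨fun u hu v hv => ?_, fun v hv => ?_, fun x hx => ?_⟩
      · have := mul_add_lt hu hv
        simp only [State.mem_setReg, State.mem_setMem, Expr.eval_hAdd, Expr.eval_reg, f0, f2, f5,
          hm₂]
        rw [if_neg (by omega)]
        exact m1 u hu v hv
      · simp only [State.mem_setReg, State.mem_setMem, Expr.eval_hAdd, Expr.eval_hMul,
          Expr.eval_reg, f0, f2, f5, hm₂, i4]
        split_ifs with h
        · obtain rfl : v = i := by omega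
          rfl
        · exact m2 v (by omega)
      · simp only [State.mem_setReg, State.mem_setMem, Expr.eval_hAdd, Expr.eval_reg, f0, f2, f5,
          hm₂]
        rw [if_neg (by omega)]
        exact m3 x hx
  exact hrun

theorem one_sub_one_sub (a b : ℕ) : 1 - (1 - (a - b)) = if b < a then 1 else 0 := by
  split_ifs <;> omega

theorem within_ranks (hw : Fit n k w) (hc : Consts n k s) (hA : ∀ u v, A u v ≤ 1)
    (hmat : ∀ u < n, ∀ v < n, s.mem (u * n + v) = A u v)
    (hkey : ∀ v < n, s.mem (n * n + n + v) = key n A v)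
    (hzero : ∀ x, n * n + 2 * n ≤ x → s.mem x = 0) :
    Within w (.forLoop 2 0 rankBody) s (n * (n * 40 + 60) + 6) fun s' =>
      (∀ u < n, ∀ v < n, s'.mem (u * n + v) = A u v) ∧
      (∀ v < n, s'.mem (n * n + rank n A v) = v) ∧
      ∀ x, n * n + 2 * n ≤ x → s'.mem x = 0 := by
  have hw1 := hw.table
  have hw0 := hw.ne_zero
  have hrun : Within w (.forLoop 2 0 rankBody) s (n * (n * 40 + 52 + 8) + 6) fun s' =>
      (∀ u < n, ∀ v < n, s'.mem (u * n + v) = A u v) ∧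
      (∀ v < n, s'.mem (n * n + rank n A v) = v) ∧
      (∀ v < n, s'.mem (n * n + n + v) = key n A v) ∧
      ∀ x, n * n + 2 * n ≤ x → s'.mem x = 0 := by
    refine Within.forLoop_frame (fun i s' => (∀ u < n, ∀ v < n, s'.mem (u * n + v) = A u v) ∧
      (∀ v < i, s'.mem (n * n + rank n A v) = v) ∧
      (∀ v < n, s'.mem (n * n + n + v) = key n A v) ∧
      ∀ x, n * n + 2 * n ≤ x → s'.mem x = 0)
      (by omega) (by decide) (by decide) (by decide) hc.r0 ⟨hmat, by simp, hkey, hzero⟩ ?_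
    rintro i hi s' ⟨m1, m2, m3, m4⟩ i2 hf -
    have hc' := hc.congr hf (by decide)
    refine Within.assign_seq (by simp) (by simp) ?_
    have hloop := Within.forLoop_frame (w := w) (x := 3) (b := 0) (N := n) (T := 32)
      (p := 4 ::= .reg 4 + (1 - (1 -
        (.load (.reg 5 + .reg 0 + .reg 2) - .load (.reg 5 + .reg 0 + .reg 3)))))
      (s₀ := s'.setReg 4 0)
      (fun j s' => s'.reg 4 = ∑ u ∈ range j, if key n A u < key n A i then 1 else 0)
      (by omega) (by decide) (by decide) (by decide) (by simp [hc'.r0]) (by simp) (by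
        rintro j hj s₂ i4 i3 hf₂ hm₂
        have f0 : s₂.reg 0 = n := by rw [hf₂ 0 (by decide)]; simp [hc'.r0]
        have f2 : s₂.reg 2 = i := by rw [hf₂ 2 (by decide)]; simp [i2]
        have f5 : s₂.reg 5 = n * n := by rw [hf₂ 5 (by decide)]; simp [hc'.r5]
        have hm : s₂.mem (n * n + n + i) = key n A i := by rw [hm₂ trivial]; exact m3 i hi
        have hm' : s₂.mem (n * n + n + j) = key n A j := by rw [hm₂ trivial]; exact m3 j hj
        have h1 := (key_le hA hi).2
        have h2 := (key_le hA hj).2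
        have hs : (∑ u ∈ range j, if key n A u < key n A i then 1 else 0) ≤ j := by
          refine (sum_le_card_nsmul _ _ 1 fun q _ => ?_).trans (by simp)
          split_ifs <;> simp
        refine Within.assign ?_ ?_ (by simp)
        · simp only [Expr.fits_hAdd, Expr.fits_hSub, Expr.fits_load, Expr.fits_reg,
            Expr.fits_ofNat, Expr.eval_hAdd, Expr.eval_hSub, Expr.eval_load, Expr.eval_reg,
            Expr.eval_ofNat, i4, i3, f0, f2, f5, hm, hm']
          omega
        · simp only [State.reg_setReg, Expr.eval_hAdd, Expr.eval_hSub, Expr.eval_load,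
            Expr.eval_reg, Expr.eval_ofNat, i4, i3, f0, f2, f5, hm, hm', sum_range_succ,
            one_sub_one_sub]
          simp)
    refine Within.seq ((hloop.frame_mem ⟨trivial, trivial, trivial⟩).mono le_rfl ?_)
      (by simp)
    rintro s₂ ⟨i4, hf₂, hm₂⟩
    rw [State.mem_setReg] at hm₂
    have f2 : s₂.reg 2 = i := by rw [hf₂ 2 (by decide)]; simp [i2]
    have f5 : s₂.reg 5 = n * n := by rw [hf₂ 5 (by decide)]; simp [hc'.r5]
    have i4 : s₂.reg 4 = rank n A i := by rw [i4, rank, card_filter]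
    have hr := rank_lt (A := A) hi
    refine Within.store ?_ ?_ ?_ (by simp)
    · simp [f5, i4]
      omega
    · simp [f2]
      omega
    · refine ⟨fun u hu v hv => ?_, fun v hv => ?_, fun v hv => ?_, fun x hx => ?_⟩
      · have := mul_add_lt hu hv
        simp only [State.mem_setReg, State.mem_setMem, Expr.eval_hAdd, Expr.eval_reg, i4, f2, f5,
          hm₂]
        rw [if_neg (by omega)]
        exact m1 u hu v hv
      · simp only [State.mem_setReg, State.mem_setMem, Expr.eval_hAdd, Expr.eval_reg, i4, f2, f5,
          hm₂]
        split_ifs with h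
        -- Ranks are injective, so no list cell is written for two vertices.
        · exact (rank_injOn (A := A) (n := n) (by simp; omega) (by simp; omega) (by omega)).symm
        · exact m2 v (by
            rcases Nat.lt_succ_iff_lt_or_eq.1 hv with h1 | rfl
            · exact h1
            · exact absurd rfl h)
      · simp only [State.mem_setReg, State.mem_setMem, Expr.eval_hAdd, Expr.eval_reg, i4, f2, f5,
          hm₂]
        rw [if_neg (by omega)]
        exact m3 v hv
      · simp only [State.mem_setReg, State.mem_setMem, Expr.eval_hAdd, Expr.eval_reg, i4, f2, f5,
          hm₂]
        rw [if_neg (by omega)]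
        exact m4 x hx
  exact hrun.mono le_rfl fun s' h => ⟨h.1, h.2.1, h.2.2.2⟩

theorem within_sortVertices {σ : ℕ → ℕ} (hσ : IsNumbering n (rank n A) σ) (hw : Fit n k w)
    (hc : Consts n k s) (hA : ∀ u v, A u v ≤ 1)
    (hmat : ∀ u < n, ∀ v < n, s.mem (u * n + v) = A u v)
    (hzero : ∀ x, n * n ≤ x → s.mem x = 0) :
    Within w sortVertices s (n * (n * 30 + 60) + 6 + (n * (n * 40 + 60) + 6)) fun s' =>
      Sorted n A σ s'.mem ∧ ∀ x, n * n + 2 * n ≤ x → s'.mem x = 0 := by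
  refine Within.seq ((within_keys hw hc hA hmat hzero).frame.mono le_rfl ?_) (by omega)
  rintro s' ⟨⟨m1, m2, m3⟩, hf⟩
  refine (within_ranks hw (hc.congr hf (by decide)) hA m1 m2 m3).mono (by omega) ?_
  rintro s'' ⟨h1, h2, h3⟩
  refine ⟨⟨h1, fun p hp => ?_, hσ.lt, hA⟩, h3⟩
  have := h2 (σ p) (hσ.lt p hp)
  rwa [hσ.right_inv p hp] at this

end

end CutDP

/-! ### Reconstruction of the ordering -/

namespace CutDP

open Finset WordRAM

/-- Find the vertex before the last one of those that have been found, and update the mask. -/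
def backBody : Program :=
  10 ::= .reg 0 - .reg 2 - 1 ;;
  17 ::= .load (.reg 9 + ((.reg 10 + 1) * .reg 6 + .reg 15)) ;;
  12 ::= (.reg 17 - 1) / (.reg 1 + 1) ;;
  -- The output overwrites matrix cells, which are no longer needed; the list and the table lie from
  -- `n * n` on.
  .store (.reg 10) (.load (.reg 5 + (.reg 10 + .reg 12 - .reg 23))) ;;
  14 ::= 1 ;;
  .forLoop 3 12 (14 ::= .reg 14 + .reg 14) ;;
  15 ::= .reg 15 + .reg 15 + 1 - .reg 14

/-- Output an ordering, if the table shows that there is one. -/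
def output : Program :=
  17 ::= .load (.reg 9 + (.reg 0 * .reg 6 + .reg 7)) ;;
  .ite (.reg 17) (15 ::= .reg 7 ;; .forLoop 2 0 backBody ;; 0 ::= 1) (0 ::= 0)

section

variable {n k w : ℕ} {A : ℕ → ℕ → ℕ} {σ : ℕ → ℕ} {s : State}

/-- An entry names the last bit `j`, and `2 * m' + 1 = m + 2 ^ j` returns the previous mask. That
mask is reachable again, so the walk never meets an empty entry. -/
theorem within_back (hw : Fit n k w) (hmem : Sorted n A σ s.mem) (hc : Consts n k s)
    (hT : Table n k (fun p q => A (σ p) (σ q)) ((n + 1) * 16 ^ k) s.mem)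
    (h15 : s.reg 15 = 4 ^ k - 1)
    (hr : Reach n k (fun p q => A (σ p) (σ q)) n (4 ^ k - 1)) :
    Within w (.forLoop 2 0 backBody) s (n * (k * 80 + 100) + 6) fun s' =>
      ∃ μ j : ℕ → ℕ, μ 0 = 4 ^ k - 1 ∧
        (∀ i < n, Edge n k (fun p q => A (σ p) (σ q)) i (μ i) (j i) (μ (i + 1))) ∧
        ∀ i < n, s'.mem i = σ (i + j i - 2 * k) := by
  have hw1 := hw.table
  have hw2 := hw.entry
  have hw0 := hw.ne_zero
  have hM2 : (n + 3) * 16 ^ k = n * 16 ^ k + 3 * 16 ^ k := by ring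
  have hM4 : (n + 1) * 16 ^ k = n * 16 ^ k + 16 ^ k := by ring
  have hk1 : (k + 1) * (4 * k + 2) = (k + 1) * (4 * k + 1) + (k + 1) := by ring
  have hk4 : 1 * (4 * k + 2) ≤ (k + 1) * (4 * k + 2) := Nat.mul_le_mul_right _ (by omega)
  have hrun : Within w (.forLoop 2 0 backBody) s (n * (k * 80 + 92 + 8) + 6) fun s' =>
      ∃ μ j : ℕ → ℕ, μ (n - n) = s'.reg 15 ∧ μ n = 4 ^ k - 1 ∧
        Reach n k (fun p q => A (σ p) (σ q)) (n - n) (μ (n - n)) ∧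
        (∀ i < n, n - n ≤ i → Edge n k (fun p q => A (σ p) (σ q)) i (μ i) (j i) (μ (i + 1))) ∧
        (∀ i < n, n - n ≤ i → s'.mem i = σ (i + j i - 2 * k)) ∧
        ∀ x, n * n ≤ x → s'.mem x = s.mem x := by
    -- After `z` rounds the chain is known on the levels from `n - z` to `n`.
    refine Within.forLoop_frame (fun z s' => ∃ μ j : ℕ → ℕ, μ (n - z) = s'.reg 15 ∧
        μ n = 4 ^ k - 1 ∧ Reach n k (fun p q => A (σ p) (σ q)) (n - z) (μ (n - z)) ∧
        (∀ i < n, n - z ≤ i → Edge n k (fun p q => A (σ p) (σ q)) i (μ i) (j i) (μ (i + 1))) ∧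
        (∀ i < n, n - z ≤ i → s'.mem i = σ (i + j i - 2 * k)) ∧
        ∀ x, n * n ≤ x → s'.mem x = s.mem x)
      (by omega) (by decide) (by decide) (by decide) hc.r0 ?_ ?_
    · exact ⟨fun _ => 4 ^ k - 1, fun _ => 0, by simp [h15], rfl, hr, fun i _ h => by omega,
        fun i _ h => by omega, fun _ _ => rfl⟩
    rintro z hz s' ⟨μ, j, i15, hμn, hreach, hedge, hout, hframe⟩ i2 hf -
    obtain ⟨c0, c1, c5, c6, c7, c8, c9, c23⟩ := hc.congr hf (by decide)
    obtain ⟨a, ha⟩ : ∃ a, a + z + 1 = n := ⟨n - z - 1, by omega⟩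
    have ea : n - z = a + 1 := by omega
    have ea' : n - (z + 1) = a := by omega
    rw [ea] at i15 hreach hedge hout
    have hlt := hreach.lt
    have hM1 : (a + 1) * 16 ^ k ≤ n * 16 ^ k := Nat.mul_le_mul_right _ (by omega)
    have hent := hT.entry_at (a := a + 1) hlt (by omega)
    rw [← hframe _ (by omega)] at hent
    generalize hu : s'.mem (n * n + 2 * n + ((a + 1) * 16 ^ k + μ (a + 1))) = u at hent
    obtain ⟨m₀, hr₀, hE⟩ := hent.edge (hent.ne_zero_iff.2 hreach)
    have hle := hent.le
    generalize hJ : (u - 1) / (k + 1) = J at hE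
    have e1 := hE.le
    have e2 := hE.lo
    have e3 := hE.hi
    have e4 := hE.eq
    have e5 := hr₀.lt
    have hp : a + J - 2 * k < n := by omega
    have l1 : s'.mem (n * n + (a + J - 2 * k)) = σ (a + J - 2 * k) := by
      rw [hframe _ (by omega), hmem.list _ hp]
    have l2 := hmem.lt _ hp
    have hnn : n ≤ n * n := Nat.le_mul_self n
    refine Within.assign_seq ?_ (by simp) ?_
    · simp [c0, i2]
      omega
    have v1 : (Expr.reg 0 - Expr.reg 2 - 1).eval s' = a := by simp [c0, i2]; omega
    rw [v1]
    refine Within.assign_seq ?_ (by simp) ?_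
    · simp [c9, c6, ← i15, hu]
      omega
    have v2 : (Expr.load (.reg 9 + ((.reg 10 + 1) * .reg 6 + .reg 15))).eval (s'.setReg 10 a) =
        u := by simp [c9, c6, ← i15, hu]
    rw [v2]
    refine Within.assign_seq ?_ (by simp) ?_
    · simp [c1]
      omega
    have v3 : ((Expr.reg 17 - 1) / (Expr.reg 1 + 1)).eval ((s'.setReg 10 a).setReg 17 u) = J := by
      simp [c1, hJ]
    rw [v3]
    refine Within.store_seq ?_ ?_ (by simp) ?_
    · simp
      omega
    · simp [c5, c23, l1]
      omega
    refine Within.assign_seq (by simp; omega) (by simp) ?_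
    have v4 : (Expr.load (.reg 5 + (.reg 10 + .reg 12 - .reg 23))).eval
        (((s'.setReg 10 a).setReg 17 u).setReg 12 J) = σ (a + J - 2 * k) := by
      simp [c5, c23, l1]
    have v5 : (Expr.reg 10).eval (((s'.setReg 10 a).setReg 17 u).setReg 12 J) = a := by simp
    rw [v4, v5]
    have hloop := Within.forLoop_frame (w := w) (x := 3) (b := 12) (N := J) (T := 4)
      (p := 14 ::= .reg 14 + .reg 14)
      (s₀ := ((((s'.setReg 10 a).setReg 17 u).setReg 12 J).setMem a
        (σ (a + J - 2 * k))).setReg 14 1)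
      (fun i s' => s'.reg 14 = 2 ^ i)
      (by omega) (by decide) (by decide) (by decide) (by simp) (by simp) (by
        rintro i hi s₂ i14 - - -
        have := two_pow_le_sixteen_pow (k := k) (J := i + 1) (by omega)
        have := two_pow_le_sixteen_pow (k := k) (J := i) (by omega)
        refine Within.assign ?_ ?_ (by simp)
        · simp [i14]
          omega
        · simp [i14, pow_succ, mul_two])
    refine Within.seq ((hloop.frame_mem (by simp [Program.forLoop, Program.Storeless])).mono
      le_rfl ?_) (by simp; omega)
    rintro s₂ ⟨i14, hf₂, hm₂⟩
    have f15 : s₂.reg 15 = μ (a + 1) := by rw [hf₂ 15 (by decide)]; simp [← i15]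
    have hpow := two_pow_le_sixteen_pow e1
    refine Within.assign ?_ ?_ (by simp; omega)
    · simp [f15, i14]
      omega
    · have hmem₂ : ∀ x, s₂.mem x = if x = a then σ (a + J - 2 * k) else s'.mem x := by
        intro x
        rw [hm₂]
        simp
      -- The chain grows downwards: only the values at the new lowest level `a` are replaced.
      refine ⟨Function.update μ a m₀, Function.update j a J, ?_, ?_, ?_, ?_, ?_, ?_⟩
      · rw [ea']
        simp [f15, i14]
        omega
      · rw [Function.update_of_ne (by omega), hμn]
      · rw [ea', Function.update_self]
        exact hr₀
      · intro i hi hai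
        rw [Function.update_of_ne (show i + 1 ≠ a by omega)]
        by_cases h : i = a
        · subst h
          rw [Function.update_self, Function.update_self]
          exact hE
        · rw [Function.update_of_ne h, Function.update_of_ne h]
          exact hedge i hi (by omega)
      · intro i hi hai
        rw [State.mem_setReg, State.mem_setReg, hmem₂]
        by_cases h : i = a
        · subst h
          rw [if_pos rfl, Function.update_self]
        · rw [if_neg h, Function.update_of_ne h]
          exact hout i hi (by omega)
      · intro x hx
        rw [State.mem_setReg, State.mem_setReg, hmem₂, if_neg (by omega), hframe x hx]
  refine hrun.mono le_rfl ?_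
  rintro s' ⟨μ, j, -, -, hreach, hedge, hout, -⟩
  rw [Nat.sub_self] at hreach
  exact ⟨μ, j, hreach, fun i hi => hedge i hi (by omega), fun i hi => hout i hi (by omega)⟩

theorem within_output (hw : Fit n k w) (hmem : Sorted n A σ s.mem) (hc : Consts n k s)
    (hT : Table n k (fun p q => A (σ p) (σ q)) ((n + 1) * 16 ^ k) s.mem) :
    Within w output s (n * (k * 80 + 100) + 40) fun s' =>
      (s'.reg 0 = 1 ∧ ∃ μ j : ℕ → ℕ, μ 0 = 4 ^ k - 1 ∧
        (∀ i < n, Edge n k (fun p q => A (σ p) (σ q)) i (μ i) (j i) (μ (i + 1))) ∧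
        ∀ i < n, s'.mem i = σ (i + j i - 2 * k)) ∨
      (s'.reg 0 = 0 ∧ ¬ Reach n k (fun p q => A (σ p) (σ q)) n (4 ^ k - 1)) := by
  have hw1 := hw.table
  have hw2 := hw.entry
  have hw0 := hw.ne_zero
  have hM2 : (n + 3) * 16 ^ k = n * 16 ^ k + 3 * 16 ^ k := by ring
  have hM4 : (n + 1) * 16 ^ k = n * 16 ^ k + 16 ^ k := by ring
  have hk1 : (k + 1) * (4 * k + 2) = (k + 1) * (4 * k + 1) + (k + 1) := by ring
  have h4 := four_pow_le k
  have h4' : 0 < 4 ^ k := by positivity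
  have hent := hT.entry_at (a := n) (m := 4 ^ k - 1) (by omega) (by omega)
  have hle := hent.le
  have hc' := hc
  obtain ⟨c0, c1, c5, c6, c7, c8, c9, c23⟩ := hc
  have hev : (Expr.load (.reg 9 + (.reg 0 * .reg 6 + .reg 7))).eval s =
      s.mem (n * n + 2 * n + (n * 16 ^ k + (4 ^ k - 1))) := by
    simp only [Expr.eval_load, Expr.eval_hAdd, Expr.eval_hMul, Expr.eval_reg, c0, c6, c7, c9]
  generalize hu : s.mem (n * n + 2 * n + (n * 16 ^ k + (4 ^ k - 1))) = u at hent hle hev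
  refine Within.assign_seq ?_ (by simp) ?_
  · rw [Expr.fits_load, ← Expr.eval_load, hev]
    simp only [Expr.fits_hAdd, Expr.fits_hMul, Expr.fits_reg, Expr.eval_hAdd, Expr.eval_hMul,
      Expr.eval_reg, c0, c6, c7, c9]
    omega
  rw [hev]
  refine Within.ite ?_ (by simp) (fun h => ?_) (fun h => ?_)
  · simp
    omega
  · have hreach := hent.ne_zero_iff.1 (by simpa using h)
    refine Within.assign_seq ?_ (by simp) ?_
    · simp [c7]
      omega
    have hb := within_back (s := (s.setReg 17 u).setReg 15 (4 ^ k - 1)) hw hmem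
      (hc'.congr (l := [17, 15]) (fun x hx => by
        simp only [List.mem_cons, not_or] at hx
        simp [hx.1, hx.2.1]) (by decide)) hT (by simp) hreach
    have hv : (Expr.reg 7).eval (s.setReg 17 u) = 4 ^ k - 1 := by simp [c7]
    rw [hv]
    refine Within.seq (hb.mono le_rfl ?_) (by simp)
    rintro s' hs'
    exact Within.assign (by simp; omega) (.inl ⟨by simp, hs'⟩) (by simp)
  · refine Within.assign (by simp) (.inr ⟨by simp, fun hreach => ?_⟩) (by simp)
    exact hent.ne_zero_iff.2 hreach (by simpa using h)

end

end CutDP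

/-! ### The complete algorithm -/

namespace CutDP

open Finset WordRAM

/-- The algorithm: sort the vertices by out-degree, compute the table and output an ordering. -/
def algorithm : Program :=
  initConsts ;; sortVertices ;; .store (.reg 9 + .reg 7) 1 ;; table ;; output

/-- A bound for the running time of the algorithm. -/
def totalTime (n k : ℕ) : ℕ :=
  (k * 50 + 60) + (n * (n * 30 + 60) + 6 + (n * (n * 40 + 60) + 6)) + 5 +
    (n * (levelTime n k + 8) + 6) + (n * (k * 80 + 100) + 40)

theorem table_init {n k : ℕ} {b : ℕ → ℕ → ℕ} {mem : ℕ → ℕ}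
    (h : ∀ x, n * n + 2 * n ≤ x → mem x = 0) :
    Table n k b (16 ^ k) (Function.update mem (n * n + 2 * n + (4 ^ k - 1)) 1) where
  entry x hx := by
    rw [Nat.div_eq_of_lt hx, Nat.mod_eq_of_lt hx]
    show _ = if x = 4 ^ k - 1 then 1 else 0
    rw [Function.update_apply, h _ (by omega)]
    simp
  zero x hx := by
    have := four_pow_le k
    have : 0 < 4 ^ k := by positivity
    rw [Function.update_of_ne (by omega)]
    exact h _ (by omega)

theorem within_algorithm {n k w : ℕ} (T : Digraph (Fin n)) (hT : T.IsSemicomplete)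
    (hw : Fit n k w) :
    Within w algorithm (inputState T k) (totalTime n k) fun s =>
      (s.reg 0 = 1 ∧ ∃ π : Fin n ≃ Fin n,
        T.orderingWidth π ≤ k ∧ ∀ i : Fin n, s.mem (i : ℕ) = (π i : ℕ)) ∨
      (s.reg 0 = 0 ∧ k < T.cutwidth) := by
  have hw1 := hw.table
  have hw0 := hw.ne_zero
  have hM2 : (n + 3) * 16 ^ k = n * 16 ^ k + 3 * 16 ^ k := by ring
  have h4 := four_pow_le k
  obtain ⟨σ, hσ⟩ := exists_isNumbering_rank n (adj T)
  refine Within.seq ((within_initConsts hw (by simp [inputState])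
    (by simp [inputState])).mono le_rfl ?_) (by unfold totalTime; omega)
  rintro s₁ ⟨hc₁, h25, hm₁⟩
  have hzero : ∀ x, n * n ≤ x → s₁.mem x = 0 := by
    intro x hx
    rw [hm₁]
    unfold inputState
    refine if_neg ?_
    rintro ⟨i, j, rfl, -⟩
    have := mul_add_lt i.2 j.2
    omega
  refine Within.seq ((within_sortVertices hσ hw hc₁ (adj_le T)
    (fun u _ v _ => by rw [hm₁]; rfl) hzero).frame.mono le_rfl ?_)
    (by unfold totalTime; omega)
  rintro s₂ ⟨⟨hS₂, hz₂⟩, hf₂⟩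
  have hc₂ := hc₁.congr hf₂ (by decide)
  have h25₂ := (hf₂ 25 (by decide)).trans h25
  refine Within.store_seq ?_ (by simp; omega) (by simp [totalTime]; omega) ?_
  · simp [hc₂.r9, hc₂.r7]
    omega
  have hv : (Expr.reg 9 + Expr.reg 7).eval s₂ = n * n + 2 * n + (4 ^ k - 1) := by
    simp [hc₂.r9, hc₂.r7]
  rw [hv]
  have hc₃ : Consts n k (s₂.setMem (n * n + 2 * n + (4 ^ k - 1)) 1) :=
    hc₂.congr (l := []) (fun _ _ => rfl) (by simp)
  refine Within.seq ((within_table (σ := σ) (A := adj T) hw (hS₂.update _ _) (adj_self T hT) hc₃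
    h25₂ (table_init hz₂)).frame.mono le_rfl ?_) (by simp [totalTime]; omega)
  rintro s₄ ⟨⟨hS₄, hT₄⟩, hf₄⟩
  refine (within_output hw hS₄ (hc₃.congr hf₄ (by decide)) hT₄).mono
    (by simp [totalTime]; omega) ?_
  rintro s₅ (⟨h0, μ, j, hμ, hE, hout⟩ | ⟨h0, hn⟩)
  · obtain ⟨π, hπ, hπ'⟩ := exists_ordering_of_edges T hσ hμ hE
    exact .inl ⟨h0, π, hπ, fun i => by rw [hout i i.2, hπ' i]⟩
  · refine .inr ⟨h0, ?_⟩
    by_contra h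
    exact hn (reach_of_cutwidth_le T hT (not_lt.1 h) hσ)

/-! ### Bounds for running time and word size -/

/-- With `K = 2 ^ k` one has `16 ^ k = K ^ 4` and `4 * k + 1 ≤ 4 * K`, so a level costs `O(K ^ 5 *
N)`, where `N = max n 1` takes care of `n = 0`. The exponent `3000` is far from tight: `5` would do
there. -/
theorem totalTime_le (n k : ℕ) : totalTime n k ≤ 3000 * 2 ^ (3000 * k) * (max n 1) ^ 2 := by
  obtain ⟨N, hN⟩ : ∃ N, N = max n 1 := ⟨_, rfl⟩
  rw [← hN]
  have hn : n ≤ N := by omega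
  have h1 : 1 ≤ N := by omega
  have hk : k + 1 ≤ 2 ^ k := Nat.lt_two_pow_self
  obtain ⟨K, hK⟩ : ∃ K, K = 2 ^ k := ⟨_, rfl⟩
  have h16 : 16 ^ k = K ^ 4 := by rw [hK, ← pow_mul, mul_comm, pow_mul]; norm_num
  rw [← hK] at hk
  have hK1 : 1 ≤ K := by omega
  have hN2 : N ≤ N ^ 2 := Nat.le_self_pow (by norm_num) N
  have hlevel : levelTime n k ≤ 1500 * (K ^ 5 * N) := by
    have e1 : (4 * k + 1) * (n * 100 + 208) + 20 + 8 ≤ K * N * 1400 := by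
      have : (4 * k + 1) * (n * 100 + 208) ≤ (4 * K) * (N * 308) :=
        Nat.mul_le_mul (by omega) (by omega)
      have : 1 * 1 ≤ K * N := Nat.mul_le_mul hK1 h1
      have e : (4 * K) * (N * 308) = 1232 * (K * N) := by ring
      linarith
    have e2 := Nat.mul_le_mul_left (K ^ 4) e1
    have e3 : K ^ 4 * (K * N * 1400) = 1400 * (K ^ 5 * N) := by ring
    have e4 : 1 * 1 ≤ K ^ 5 * N := Nat.mul_le_mul (Nat.one_le_pow _ _ hK1) h1
    unfold levelTime
    rw [h16]
    linarith
  have hpow : K ^ 5 ≤ 2 ^ (3000 * k) := by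
    rw [hK, ← pow_mul]
    exact Nat.pow_le_pow_right (by norm_num) (by omega)
  have hKK : K ≤ K ^ 5 := Nat.le_self_pow (by norm_num) K
  have m1 : n * levelTime n k ≤ N * (1500 * (K ^ 5 * N)) := Nat.mul_le_mul hn hlevel
  have m2 : n * n ≤ N * N := Nat.mul_le_mul hn hn
  have m3 : n * k ≤ N * K ^ 5 := Nat.mul_le_mul hn (by omega)
  have e1 : N * (1500 * (K ^ 5 * N)) = 1500 * (K ^ 5 * N ^ 2) := by ring
  have e2 : N * N ≤ K ^ 5 * N ^ 2 := by
    rw [← pow_two]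
    exact Nat.le_mul_of_pos_left _ (by omega)
  have e3 : N * K ^ 5 ≤ K ^ 5 * N ^ 2 := by
    rw [mul_comm N]
    exact Nat.mul_le_mul_left _ hN2
  have e4 : K ^ 5 * 1 ≤ K ^ 5 * N ^ 2 := Nat.mul_le_mul_left _ (by omega)
  have e5 : N ≤ N * K ^ 5 := Nat.le_mul_of_pos_right _ (by omega)
  have hle : totalTime n k ≤ 3000 * (K ^ 5 * N ^ 2) := by
    have e : totalTime n k = k * 50 + 223 + 70 * (n * n) + 228 * n + n * levelTime n k +
        80 * (n * k) - 100 := by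
      unfold totalTime
      have : n * (n * 30 + 60) = 30 * (n * n) + 60 * n := by ring
      have : n * (n * 40 + 60) = 40 * (n * n) + 60 * n := by ring
      have : n * (levelTime n k + 8) = n * levelTime n k + 8 * n := by ring
      have : n * (k * 80 + 100) = 80 * (n * k) + 100 * n := by ring
      omega
    omega
  calc totalTime n k ≤ 3000 * (K ^ 5 * N ^ 2) := hle
    _ ≤ 3000 * (2 ^ (3000 * k) * N ^ 2) :=
      Nat.mul_le_mul_left _ (Nat.mul_le_mul_right _ hpow)
    _ = _ := by ring

/-- `X = 2 ^ (k + Nat.log 2 n + 1)` bounds `n` and `k + 1`, and `X ^ 4` bounds `16 ^ k`. Every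
quantity in `Fit` is then at most `X ^ 16`, which is less than `X ^ 17 ≤ 2 ^ w`. -/
theorem fit_of_le {n k w : ℕ} (hw : 3000 * (k + Nat.log 2 n + 1) ≤ w) : Fit n k w := by
  obtain ⟨E, hE⟩ : ∃ E, E = k + Nat.log 2 n + 1 := ⟨_, rfl⟩
  obtain ⟨X, hX⟩ : ∃ X, X = 2 ^ E := ⟨_, rfl⟩
  have hn : n ≤ X := by
    rw [hX]
    exact (Nat.lt_pow_succ_log_self (by norm_num) n).le.trans
      (Nat.pow_le_pow_right (by norm_num) (by omega))
  have hk : k + 1 ≤ X := by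
    rw [hX]
    exact Nat.lt_two_pow_self.trans_le (Nat.pow_le_pow_right (by norm_num) (by omega))
  have hX2 : 2 ≤ X := by
    rw [hX]
    exact Nat.le_self_pow (by omega) 2
  have h16 : 16 ^ k ≤ X ^ 4 := by
    calc 16 ^ k = (2 ^ k) ^ 4 := by rw [← pow_mul, mul_comm, pow_mul]; norm_num
      _ ≤ X ^ 4 := Nat.pow_le_pow_left
        (hX ▸ Nat.pow_le_pow_right (by norm_num) (by omega)) 4
  have hXw : X ^ 17 ≤ 2 ^ w := by
    rw [hX, ← pow_mul]
    exact Nat.pow_le_pow_right (by norm_num) (by omega)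
  have hlt : X ^ 16 < X ^ 17 := Nat.pow_lt_pow_right (by omega) (by norm_num)
  have p5 : 2 ^ 5 ≤ X ^ 5 := Nat.pow_le_pow_left hX2 5
  have p7 : 2 ^ 7 ≤ X ^ 7 := Nat.pow_le_pow_left hX2 7
  have mono : ∀ i j, i ≤ j → X ^ i ≤ X ^ j := fun i j h => Nat.pow_le_pow_right (by omega) h
  constructor
  · have h1 : n + 4 * k + 17 ≤ X ^ 6 := by
      have : 2 ^ 5 * X ≤ X ^ 5 * X := Nat.mul_le_mul_right _ p5
      have e : X ^ 5 * X = X ^ 6 := by ring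
      omega
    have h2 := Nat.mul_le_mul h16 (Nat.mul_le_mul h1 h1)
    have e : X ^ 4 * (X ^ 6 * X ^ 6) = X ^ 16 := by ring
    omega
  · have h1 : n * n ≤ X * X := Nat.mul_le_mul hn hn
    have h2 : (n + 3) * 16 ^ k ≤ (4 * X) * X ^ 4 := Nat.mul_le_mul (by omega) h16
    have e1 : X * X = X ^ 2 := by ring
    have e2 : (4 * X) * X ^ 4 = 4 * X ^ 5 := by ring
    have e3 := mono 2 5 (by norm_num)
    have e4 := mono 1 5 (by norm_num)
    rw [pow_one] at e4
    have e5 : 2 ^ 7 * X ^ 5 ≤ X ^ 7 * X ^ 5 := Nat.mul_le_mul_right _ p7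
    have e6 : X ^ 7 * X ^ 5 = X ^ 12 := by ring
    have e7 := mono 12 16 (by norm_num)
    omega
  · have h1 : (k + 1) * (4 * k + 2) ≤ X * (4 * X) := Nat.mul_le_mul hk (by omega)
    have e1 : X * (4 * X) = 4 * X ^ 2 := by ring
    have e4 := mono 1 2 (by norm_num)
    rw [pow_one] at e4
    have e5 : 2 ^ 7 * X ^ 2 ≤ X ^ 7 * X ^ 2 := Nat.mul_le_mul_right _ p7
    have e6 : X ^ 7 * X ^ 2 = X ^ 9 := by ring
    have e7 := mono 9 16 (by norm_num)
    omega

end CutDP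

/-- There are a fixed program and a constant `C` such that, for every semi-complete digraph `T` on
`n` vertices and every `k`, on a machine with words of at least `C * (k + log n + 1)` bits the
program halts on input `(T, k)` within `C * 2 ^ (C * k) * n ^ 2` steps, and either register `0`
holds `1` and the memory cells `0, …, n - 1` list an ordering of the vertices of width at most `k`,
or register `0` holds `0` and the cutwidth of `T` exceeds `k`. -/
theorem mainTheorem4 :
    ∃ (P : WordRAM.Program) (C : ℕ),
      ∀ (n k : ℕ) (T : Digraph (Fin n)), T.IsSemicomplete →
        ∀ w : ℕ, C * (k + Nat.log 2 n + 1) ≤ w →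
          ∃ (t : ℕ) (s : WordRAM.State),
            WordRAM.Runs w P (WordRAM.inputState T k) t s ∧
            t ≤ C * 2 ^ (C * k) * (max n 1) ^ 2 ∧
            ((s.reg 0 = 1 ∧ ∃ π : Fin n ≃ Fin n,
                T.orderingWidth π ≤ k ∧ ∀ i : Fin n, s.mem (i : ℕ) = (π i : ℕ)) ∨
              (s.reg 0 = 0 ∧ k < T.cutwidth)) :=
  ⟨CutDP.algorithm, 3000, fun n k T hT _ hw =>
    (CutDP.within_algorithm T hT (CutDP.fit_of_le hw)).of_le (CutDP.totalTime_le n k)⟩
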